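/- Let $d$ be a non-negative integer and let $\rho(x)=(2\pi)^{-d/2}e^{-x^2/2}$ be the standard Gaussian density on $\mathbb{R}^d$, where $x^2=x_1^2+\cdots+x_d^2$; write $L^p(\mathbb{R}^d,\rho)$ for the space of complex-valued functions $L^p(\mathbb{R}^d,\rho(x)\,dx)$. For $1<p<\infty$ and $f\in L^p(\mathbb{R}^d,\rho)$, the Segal–Bargmann transform of $f$ is the function on $\mathbb{C}^d$ given by the absolutely convergent integral \[ Sf(z)=(2\pi)^{-d/2}\int_{\mathbb{R}^d}e^{-(z-x)^2/2}f(x)\,dx,\qquad z\in\mathbb{C}^d, \] where $w^2=w_1^2+\cdots+w_d^2$ for $w\in\mathbb{C}^d$. Theorem. Fix $p$ with $2\le p<\infty$ and let $p'$ be the conjugate exponent to $p$, i.e. $\frac1p+\frac1{p'}=1$. Suppose $F$ is a holomorphic function on $\mathbb{C}^d$ such that \[ \int_{\mathbb{R}^d\times\mathbb{R}^d}\left|F(x+iy)\,e^{-y^2/2}\,e^{-x^2/(2(p-1))}\right|^{p'}\,dx\,dy<\infty . \] Then there exists a unique $f\in L^p(\mathbb{R}^d,\rho)$ with $Sf=F$.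 -/

import Mathlib

open MeasureTheory

/-- The space `ℝ^d`, with its Euclidean norm and Lebesgue measure. -/
abbrev RSpace (d : ℕ) : Type := EuclideanSpace ℝ (Fin d)

/-- The space `ℂ^d`. -/
abbrev CSpace (d : ℕ) : Type := EuclideanSpace ℂ (Fin d)

/-- The point `x + i y` of `ℂ^d`, for `x, y ∈ ℝ^d`. -/
noncomputable def complexPoint {d : ℕ} (x y : RSpace d) : CSpace d :=
  WithLp.toLp 2 fun j => (x j : ℂ) + (y j : ℂ) * Complex.I

/-- The standard Gaussian density `(2π)^(-d/2) exp (-x²/2)` on `ℝ^d`. -/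
noncomputable def gaussianDensity {d : ℕ} (x : RSpace d) : ℝ :=
  (2 * Real.pi) ^ (-(d : ℝ) / 2) * Real.exp (-(∑ j, x j ^ 2) / 2)

/-- The entire analytic continuation of the Gaussian density to `ℂ^d`; here
`z² = z₁² + ⋯ + z_d²`, without absolute values. -/
noncomputable def gaussianDensityC {d : ℕ} (z : CSpace d) : ℂ :=
  (((2 * Real.pi) ^ (-(d : ℝ) / 2) : ℝ) : ℂ) * Complex.exp (-(∑ j, z j ^ 2) / 2)

/-- The Gaussian measure `ρ(x) dx` on `ℝ^d`. -/
noncomputable def gaussianMeasure (d : ℕ) : Measure (RSpace d) :=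
  volume.withDensity fun x => ENNReal.ofReal (gaussianDensity x)

/-- The Segal-Bargmann transform `Sf(z) = ∫ ρ(z - x) f(x) dx`, the integral being over `ℝ^d` with
respect to Lebesgue measure. It converges absolutely for every `f ∈ L^p(ℝ^d, ρ)`, `1 < p < ∞`. -/
noncomputable def segalBargmann {d : ℕ} (f : RSpace d → ℂ) (z : CSpace d) : ℂ :=
  ∫ x : RSpace d, gaussianDensityC (z - complexPoint x 0) * f x

open scoped FourierTransform ENNReal

/-! ### Plancherel for integrable functions and injectivity of the Fourier transform -/

section HausdorffYoung

variable {V : Type*} [NormedAddCommGroup V] [InnerProductSpace ℝ V] [MeasurableSpace V]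
  [BorelSpace V] [FiniteDimensional ℝ V]

/-! The inverse of `S` is explicit: `f(u) = (2π)^(-d/2) ∫ F(u + iy) e^{-y²/2} dy` (`sbInverse`),
provided `F` grows more slowly than `e^{a|z|²/2}` for some `a < 1`. The integrand is the restriction
to `Re z = u` of the entire function `F(z) e^{(z-u)²/2}`, so the contour may be moved to `Re z = x`
for any `x`. This exhibits `f(u) e^{-|x-u|²/2}`, for every `x`, as a rescaled Fourier transform in
`y` of `F(x+iy) e^{-y²/2} e^{i x·y}` (`fourier_fiber`). Fourier inversion on that fibre gives `Sf =
F` (`segalBargmann_sbInverse`).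

The norm bound comes from the same identity. Hausdorff-Young on each fibre controls `∫ |f(u)|^p
e^{-p|x-u|²/2} du` by the `p'`-integral over the fibre at `x`, to the power `p-1`. Multiply by
`e^{-p x²/(2(p-1))}`, which completes the square to `e^{-u²/2}` times a Gaussian in `x -
((p-1)/p)u`; then take the power `1/(p-1) ≤ 1` and integrate in `x`. A reverse Minkowski inequality
(`mul_lintegral_rpow_le`) pulls that power outside the `u`-integral, leaving `‖f‖` in `L^p(ρ)`
against the weighted norm of `F`. The sharp constant is not needed, so Hausdorff-Young is obtained
by real interpolation between `L¹` and `L²`.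

A general `F` of finite norm has only the critical growth `e^{|z|²/2 + O(|z|)}`, by the sub-mean
value property. Its dilates `F(rz)`, `r < 1`, are admissible and converge to `F` in the weighted
norm, so their inverse transforms are Cauchy in `L^p(ρ)`. The limit is mapped to `F` because
evaluation of `S` at a point is continuous on `L^p(ρ)`. Uniqueness holds because on `iℝ^d` the
transform is, up to a nonvanishing factor, the Fourier transform of `ρf`. -/

theorem integral_fourier_smul_eq_of_integrable {f g : V → ℂ} (hf : Integrable f)
    (hg : Integrable g) : ∫ ξ, 𝓕 f ξ • g ξ = ∫ x, f x • 𝓕 g x := by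
  simpa using! VectorFourier.integral_fourierIntegral_smul_eq_flip (L := innerₗ V)
    Real.continuous_fourierChar continuous_inner hf hg

theorem continuous_fourier_of_integrable {f : V → ℂ} (hf : Integrable f) : Continuous (𝓕 f) :=
  VectorFourier.fourierIntegral_continuous Real.continuous_fourierChar
    (L := innerₗ V) continuous_inner hf

theorem enorm_fourier_le (f : V → ℂ) (w : V) : ‖𝓕 f w‖ₑ ≤ ∫⁻ v, ‖f v‖ₑ := by
  rw [Real.fourier_eq]
  refine (enorm_integral_le_lintegral_enorm _).trans (le_of_eq ?_)
  refine lintegral_congr fun v => ?_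
  rw [← ofReal_norm, ← ofReal_norm, Circle.norm_smul]

/-- A locally integrable function orthogonal to all Schwartz functions vanishes almost
everywhere. -/
theorem ae_eq_zero_of_integral_schwartz_smul_eq_zero {f : V → ℂ} (hf : LocallyIntegrable f)
    (h : ∀ g : SchwartzMap V ℂ, ∫ x, g x • f x = 0) : ∀ᵐ x, f x = 0 := by
  apply ae_eq_zero_of_integral_contDiff_smul_eq_zero hf
  intro g hg hc
  have hc' : HasCompactSupport (fun x => (g x : ℂ)) := hc.comp_left Complex.ofReal_zero
  have hg' : ContDiff ℝ (↑(⊤ : ℕ∞)) (fun x => (g x : ℂ)) := Complex.ofRealCLM.contDiff.comp hg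
  simpa using h (hc'.toSchwartzMap hg')

theorem ae_eq_zero_of_fourier_eq_zero {f : V → ℂ} (hf : Integrable f) (h : 𝓕 f = 0) :
    ∀ᵐ x, f x = 0 := by
  apply ae_eq_zero_of_integral_schwartz_smul_eq_zero hf.locallyIntegrable
  intro g
  have h1 := integral_fourier_smul_eq_of_integrable (SchwartzMap.integrable (𝓕⁻ g)) hf
  rw [← SchwartzMap.fourier_coe, FourierTransform.fourier_fourierInv_eq] at h1
  rw [h1, h]
  simp

/-- The Fourier integral and the `L²` Fourier transform pair identically with every Schwartz
function, hence agree almost everywhere, and the latter is an isometry. -/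
theorem lintegral_enorm_fourier_sq {f : V → ℂ} (hf : Integrable f) (hf2 : MemLp f 2) :
    ∫⁻ w, ‖𝓕 f w‖ₑ ^ (2 : ℝ) = ∫⁻ v, ‖f v‖ₑ ^ (2 : ℝ) := by
  set F : Lp ℂ 2 (volume : Measure V) := hf2.toLp f with hF
  obtain ⟨G, hG⟩ : ∃ G : Lp ℂ 2 (volume : Measure V), 𝓕 F = G := ⟨_, rfl⟩
  have key : ∀ᵐ w, 𝓕 f w - G w = 0 := by
    have hloc : LocallyIntegrable (G : V → ℂ) :=
      (Lp.memLp G).locallyIntegrable (by norm_num)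
    apply ae_eq_zero_of_integral_schwartz_smul_eq_zero
      ((continuous_fourier_of_integrable hf).locallyIntegrable.sub hloc)
    intro g
    have h1 := integral_fourier_smul_eq_of_integrable (SchwartzMap.integrable g) hf
    have h2 := congrArg (fun T => T g) (Lp.fourier_toTemperedDistribution_eq F)
    rw [hG] at h2
    simp only [TemperedDistribution.fourier_apply, Lp.toTemperedDistribution_apply] at h2
    have h3 : ∫ x, (𝓕 g) x • F x = ∫ x, (𝓕 (g : V → ℂ)) x • f x := by
      apply integral_congr_ae
      filter_upwards [hf2.coeFn_toLp] with x hx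
      rw [hF, hx, SchwartzMap.fourier_coe]
    have hi1 : Integrable (fun x => g x • 𝓕 f x) := by
      refine (SchwartzMap.integrable g).mul_bdd (c := (∫⁻ v, ‖f v‖ₑ).toReal)
        (continuous_fourier_of_integrable hf).aestronglyMeasurable (Filter.Eventually.of_forall ?_)
      intro w
      rw [← toReal_enorm]
      exact ENNReal.toReal_mono hf.2.ne (enorm_fourier_le f w)
    have hi2 : Integrable (fun x => g x • G x) :=
      (Lp.memLp G).integrable_mul (SchwartzMap.memLp g 2) |>.congr
        (Filter.Eventually.of_forall fun x => mul_comm _ _)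
    simp only [Pi.sub_apply, smul_sub]
    rw [integral_sub hi1 hi2, ← h1, ← h2, h3, sub_self]
  have hn : eLpNorm (𝓕 f) 2 volume = eLpNorm f 2 volume := by
    have h1 : eLpNorm (𝓕 f) 2 volume = eLpNorm G 2 volume := by
      apply eLpNorm_congr_ae
      filter_upwards [key] with w hw using sub_eq_zero.mp hw
    rw [h1, ← eLpNorm_congr_ae hf2.coeFn_toLp, ← ENNReal.toReal_eq_toReal_iff'
      (Lp.memLp G).2.ne (Lp.memLp F).2.ne, ← Lp.norm_def, ← Lp.norm_def, ← hG, Lp.norm_fourier_eq]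
  rw [eLpNorm_eq_lintegral_rpow_enorm_toReal two_ne_zero ENNReal.ofNat_ne_top,
    eLpNorm_eq_lintegral_rpow_enorm_toReal two_ne_zero ENNReal.ofNat_ne_top] at hn
  simpa using ENNReal.rpow_left_injective (by norm_num) hn

end HausdorffYoung

/-! ### The Hausdorff-Young inequality by real interpolation -/

section HausdorffYoung

variable {V : Type*} [NormedAddCommGroup V] [InnerProductSpace ℝ V] [MeasurableSpace V]
  [BorelSpace V] [FiniteDimensional ℝ V]

/-- The weak-type estimate behind the interpolation between `L¹` and `L²`: cutting `h` at height
`s` with `∫ ‖h‖ ≤ t / 2` above that height, the level set of `𝓕 h` is controlled by the part of `h`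
below `s`. -/
theorem measure_lt_norm_fourier_le {h : V → ℂ} (hi : Integrable h) (hm : Measurable h)
    {s t : ℝ} (ht : 0 < t)
    (hs : ∫⁻ v in {v | s < ‖h v‖}, ‖h v‖ₑ ≤ ENNReal.ofReal (t / 2)) :
    volume {w | t < ‖𝓕 h w‖} ≤
      ENNReal.ofReal (4 / t ^ 2) * ∫⁻ v in {v | ‖h v‖ ≤ s}, ‖h v‖ₑ ^ (2 : ℝ) := by
  set U : Set V := {v | s < ‖h v‖} with hU
  have hUm : MeasurableSet U := measurableSet_lt measurable_const hm.norm
  have hUc : Uᶜ = {v | ‖h v‖ ≤ s} := by ext v; simp [hU]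
  set h₁ := U.indicator h
  set h₂ := Uᶜ.indicator h
  have hi₁ : Integrable h₁ := hi.indicator hUm
  have hi₂ : Integrable h₂ := hi.indicator hUm.compl
  have hsum : h = h₁ + h₂ := (Set.indicator_self_add_compl U h).symm
  have hF : ∀ w, 𝓕 h w = 𝓕 h₁ w + 𝓕 h₂ w := by
    intro w
    rw [hsum]
    simp only [Real.fourier_eq, Pi.add_apply, smul_add]
    exact integral_add ((Real.fourierIntegral_convergent_iff w).2 hi₁)
      ((Real.fourierIntegral_convergent_iff w).2 hi₂)
  have h₁le : ∀ w, ‖𝓕 h₁ w‖ ≤ t / 2 := by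
    intro w
    have := (enorm_fourier_le h₁ w).trans
      (le_of_eq_of_le (by
        rw [← lintegral_indicator hUm]
        exact lintegral_congr fun v => enorm_indicator_eq_indicator_enorm _ _) hs)
    rw [← ofReal_norm] at this
    exact (ENNReal.ofReal_le_ofReal_iff (by positivity)).1 this
  have hL2 : MemLp h₂ 2 := by
    rw [memLp_two_iff_integrable_sq_norm hi₂.1]
    refine (hi₂.norm.mul_bdd (c := max s 0) hi₂.norm.1
      (Filter.Eventually.of_forall fun v => ?_)).congr
      (Filter.Eventually.of_forall fun v => (sq _).symm)
    rw [norm_norm]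
    by_cases hv : v ∈ Uᶜ
    · rw [show h₂ v = h v from Set.indicator_of_mem hv h]
      rw [hUc] at hv
      exact le_max_of_le_left hv
    · rw [show h₂ v = 0 from Set.indicator_of_notMem hv h, norm_zero]
      exact le_max_right _ _
  have hp := lintegral_enorm_fourier_sq hi₂ hL2
  -- The high part contributes at most `t / 2` everywhere, so the low part must supply the other
  -- half; Chebyshev and Plancherel then apply to it.
  have hsub : {w | t < ‖𝓕 h w‖} ⊆ {w | ENNReal.ofReal (t ^ 2 / 4) ≤ ‖𝓕 h₂ w‖ₑ ^ (2 : ℝ)} := by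
    intro w hw
    have h3 : t / 2 ≤ ‖𝓕 h₂ w‖ := by
      have := norm_add_le (𝓕 h₁ w) (𝓕 h₂ w)
      rw [← hF] at this
      have := h₁le w
      have : t < ‖𝓕 h w‖ := hw
      linarith
    have h4 : t ^ 2 / 4 ≤ ‖𝓕 h₂ w‖ ^ (2 : ℝ) := by
      rw [Real.rpow_two]; nlinarith
    rw [Set.mem_ofPred_eq, ← ofReal_norm, ENNReal.ofReal_rpow_of_nonneg (norm_nonneg _) (by norm_num)]
    exact ENNReal.ofReal_le_ofReal h4
  refine (measure_mono hsub).trans ?_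
  have hpos : 0 < t ^ 2 / 4 := by positivity
  refine (meas_ge_le_lintegral_div
    ((continuous_fourier_of_integrable hi₂).measurable.enorm.pow_const _).aemeasurable
    (ENNReal.ofReal_pos.2 hpos).ne' ENNReal.ofReal_ne_top).trans ?_
  rw [hp, ENNReal.div_eq_inv_mul, ← ENNReal.ofReal_inv_of_pos hpos, inv_div, ← hUc,
    ← lintegral_indicator hUm.compl]
  gcongr with v
  by_cases hv : v ∈ Uᶜ <;> simp [h₂, hv]

theorem setLIntegral_rpow_Ioc {T r : ℝ} (hT : 0 ≤ T) (hr : 0 < r) :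
    ∫⁻ t in Set.Ioc 0 T, ENNReal.ofReal (t ^ (r - 1)) = ENNReal.ofReal (T ^ r / r) := by
  have h1 : IntegrableOn (fun t : ℝ => t ^ (r - 1)) (Set.Ioc 0 T) := by
    rw [← intervalIntegrable_iff_integrableOn_Ioc_of_le hT]
    exact intervalIntegral.intervalIntegrable_rpow' (by linarith)
  rw [← ofReal_integral_eq_lintegral_ofReal h1, ← intervalIntegral.integral_of_le hT,
    integral_rpow (Or.inl (by linarith))]
  · simp [Real.zero_rpow hr.ne']
  · filter_upwards [ae_restrict_mem measurableSet_Ioc] with t ht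
    exact Real.rpow_nonneg ht.1.le _

/-- The Hausdorff-Young inequality, with an unspecified constant. -/
theorem exists_lintegral_enorm_fourier_rpow_le {p : ℝ} (hp : 2 ≤ p) :
    ∃ C : ℝ≥0∞, C ≠ ⊤ ∧ ∀ h : V → ℂ, Integrable h → Measurable h →
      ∫⁻ w, ‖𝓕 h w‖ₑ ^ p ≤ C * (∫⁻ v, ‖h v‖ₑ ^ (p / (p - 1))) ^ (p - 1) := by
  -- The endpoint `p = 2` is Plancherel; the interpolation fails there because `∫ t^(p-3) dt`
  -- diverges at `0`.
  rcases hp.eq_or_lt with rfl | hp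
  · refine ⟨1, ENNReal.one_ne_top, fun h hi hm => ?_⟩
    norm_num
    by_cases hf : ∫⁻ v, ‖h v‖ₑ ^ (2 : ℝ) = ⊤
    · simp at hf; simp [hf]
    · have : MemLp h 2 := ⟨hi.1, by
        rw [eLpNorm_lt_top_iff_lintegral_rpow_enorm_lt_top two_ne_zero ENNReal.ofNat_ne_top]
        simpa [lt_top_iff_ne_top] using hf⟩
      simpa using (lintegral_enorm_fourier_sq hi this).le
  refine ⟨ENNReal.ofReal (p * (4 * 2 ^ (p - 2) / (p - 2))), ENNReal.ofReal_ne_top,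
    fun h hi hm => ?_⟩
  have hp1 : 0 < p - 1 := by linarith
  have hp2 : 0 < p - 2 := by linarith
  set A := ∫⁻ v, ‖h v‖ₑ ^ (p / (p - 1)) with hA
  have hCpos : 0 < p * (4 * 2 ^ (p - 2) / (p - 2)) := by positivity
  by_cases hAt : A = ⊤
  · rw [hAt, ENNReal.top_rpow_of_pos hp1, ENNReal.mul_top (ENNReal.ofReal_pos.2 hCpos).ne']
    exact le_top
  by_cases hA0 : A = 0
  · have h0 : ∀ᵐ v, h v = 0 := by
      rw [hA, lintegral_eq_zero_iff (hm.enorm.pow_const _)] at hA0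
      filter_upwards [hA0] with v hv
      have : 0 < p / (p - 1) := by positivity
      simpa [this, this.le, not_lt_of_ge this.le] using hv
    have h1 : ∀ w, 𝓕 h w = 0 := by
      intro w
      rw [Real.fourier_eq]
      rw [integral_eq_zero_of_ae]
      filter_upwards [h0] with v hv
      simp [hv]
    have : 0 < p := by linarith
    simp [h1, this]
  set a := A.toReal with ha
  have ha0 : 0 < a := ENNReal.toReal_pos hA0 hAt
  have hAa : A = ENNReal.ofReal a := (ENNReal.ofReal_toReal hAt).symm
  -- The cut depends on the level `t`: above height `S t` one has `‖h‖ ≤ (t / 2a) ‖h‖^(p/(p-1))`,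
  -- and the integral of the right side is `t / 2`.
  set S : ℝ → ℝ := fun t => (2 * a / t) ^ (p - 1) with hS
  have hhigh : ∀ t > 0, ∫⁻ v in {v | S t < ‖h v‖}, ‖h v‖ₑ ≤ ENNReal.ofReal (t / 2) := by
    intro t ht
    have hb : ∀ v ∈ {v | S t < ‖h v‖}, ‖h v‖ₑ ≤
        ENNReal.ofReal (t / (2 * a)) * ‖h v‖ₑ ^ (p / (p - 1)) := by
      intro v hv
      have hv' : (2 * a / t) ^ (p - 1) < ‖h v‖ := hv
      have hpos : 0 < ‖h v‖ := lt_trans (by positivity) hv'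
      rw [← ofReal_norm, ENNReal.ofReal_rpow_of_pos hpos, ← ENNReal.ofReal_mul (by positivity)]
      apply ENNReal.ofReal_le_ofReal
      have e : p / (p - 1) = 1 + 1 / (p - 1) := by field_simp; ring
      rw [e, Real.rpow_add hpos, Real.rpow_one]
      have : 2 * a / t ≤ ‖h v‖ ^ (1 / (p - 1)) := by
        have := Real.rpow_le_rpow (by positivity) hv'.le (show 0 ≤ 1 / (p - 1) by positivity)
        rwa [← Real.rpow_mul (by positivity), mul_one_div_cancel hp1.ne', Real.rpow_one] at this
      calc ‖h v‖ = t / (2 * a) * (‖h v‖ * (2 * a / t)) := by field_simp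
        _ ≤ _ := by gcongr
    calc _ ≤ ∫⁻ v in {v | S t < ‖h v‖}, ENNReal.ofReal (t / (2 * a)) * ‖h v‖ₑ ^ (p / (p - 1)) :=
          setLIntegral_mono' (measurableSet_lt measurable_const hm.norm) hb
      _ ≤ ∫⁻ v, ENNReal.ofReal (t / (2 * a)) * ‖h v‖ₑ ^ (p / (p - 1)) := setLIntegral_le_lintegral _ _
      _ = ENNReal.ofReal (t / 2) := by
          rw [lintegral_const_mul _ (hm.enorm.pow_const _), ← hA, hAa,
            ← ENNReal.ofReal_mul (by positivity)]
          congr 1; field_simp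
  have hlay := lintegral_rpow_eq_lintegral_meas_lt_mul volume (f := fun w => ‖𝓕 h w‖)
    (Filter.Eventually.of_forall fun w => norm_nonneg _)
    (continuous_fourier_of_integrable hi).norm.measurable.aemeasurable (p := p) (by linarith)
  have hl : ∫⁻ w, ‖𝓕 h w‖ₑ ^ p = ∫⁻ w, ENNReal.ofReal (‖𝓕 h w‖ ^ p) := lintegral_congr fun w => by
    rw [← ofReal_norm, ENNReal.ofReal_rpow_of_nonneg (norm_nonneg _) (by linarith)]
  -- the set of pairs `(t, v)` with `‖h v‖ ≤ S t`, sliced both ways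
  set D : Set (ℝ × V) := {q | 0 < q.1 ∧ ‖h q.2‖ ≤ S q.1} with hD
  have hSm : Measurable S := (measurable_const.div measurable_id).pow_const _
  have hDm : MeasurableSet D :=
    (measurableSet_lt measurable_const measurable_fst).inter
      (measurableSet_le (hm.comp measurable_snd).norm (hSm.comp measurable_fst))
  set k : ℝ × V → ℝ≥0∞ := D.indicator
    fun q => ENNReal.ofReal (4 * q.1 ^ (p - 2 - 1)) * ‖h q.2‖ₑ ^ (2 : ℝ) with hk
  have hkm : Measurable k := by
    refine Measurable.indicator ?_ hDm
    exact (((measurable_fst.pow_const _).const_mul _).ennreal_ofReal).mul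
      ((hm.comp measurable_snd).enorm.pow_const _)
  have hstep : ∫⁻ t in Set.Ioi (0 : ℝ), volume {w | t < ‖𝓕 h w‖} * ENNReal.ofReal (t ^ (p - 1)) ≤
      ∫⁻ t, ∫⁻ v, k (t, v) := by
    rw [← lintegral_indicator measurableSet_Ioi]
    apply lintegral_mono
    intro t
    by_cases ht : t ∈ Set.Ioi (0 : ℝ)
    swap
    · simp [ht]
    have ht' : 0 < t := ht
    rw [Set.indicator_of_mem ht]
    calc _ ≤ ENNReal.ofReal (4 / t ^ 2) * (∫⁻ v in {v | ‖h v‖ ≤ S t}, ‖h v‖ₑ ^ (2 : ℝ))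
            * ENNReal.ofReal (t ^ (p - 1)) := by
          gcongr
          exact measure_lt_norm_fourier_le hi hm ht' (hhigh t ht')
      _ = ENNReal.ofReal (4 * t ^ (p - 2 - 1)) * ∫⁻ v in {v | ‖h v‖ ≤ S t}, ‖h v‖ₑ ^ (2 : ℝ) := by
          rw [mul_right_comm, ← ENNReal.ofReal_mul (by positivity)]
          congr 2
          rw [show p - 1 = (p - 2 - 1) + 2 by ring, Real.rpow_add ht', Real.rpow_two]
          field_simp
      _ = ∫⁻ v, k (t, v) := by
          rw [← lintegral_const_mul _ (hm.enorm.pow_const _),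
            ← lintegral_indicator (measurableSet_le hm.norm measurable_const)]
          refine lintegral_congr fun v => ?_
          simp [hk, hD, Set.indicator_apply, ht']
  -- For fixed `v` with `h v ≠ 0`, the condition `‖h v‖ ≤ S t` means `t ≤ T` with `T` proportional
  -- to `‖h v‖^(-1/(p-1))`, and `T^(p-2) ‖h v‖²` has exactly the exponent `p/(p-1)`.
  have hinner : ∀ v, ∫⁻ t, k (t, v) ≤
      ENNReal.ofReal (4 * (2 * a) ^ (p - 2) / (p - 2)) * ‖h v‖ₑ ^ (p / (p - 1)) := by
    intro v
    by_cases hv : h v = 0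
    · simp [hk, hv, Set.indicator_apply]
    have hpos : 0 < ‖h v‖ := norm_pos_iff.2 hv
    set T := 2 * a * ‖h v‖ ^ (-(1 / (p - 1))) with hT
    have hT0 : 0 < T := by positivity
    have hle : ∀ t, k (t, v) ≤ (Set.Ioc 0 T).indicator
        (fun t => ENNReal.ofReal (t ^ (p - 2 - 1))) t * (4 * ‖h v‖ₑ ^ (2 : ℝ)) := by
      intro t
      by_cases ht : (t, v) ∈ D
      swap
      · simp [hk, ht]
      have ht0 : 0 < t := ht.1
      have ht1 : ‖h v‖ ≤ (2 * a / t) ^ (p - 1) := ht.2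
      have : t ∈ Set.Ioc 0 T := by
        refine ⟨ht0, ?_⟩
        have := Real.rpow_le_rpow (by positivity) ht1 (show 0 ≤ 1 / (p - 1) by positivity)
        rw [← Real.rpow_mul (by positivity), mul_one_div_cancel hp1.ne', Real.rpow_one,
          le_div_iff₀ ht0] at this
        rw [hT, Real.rpow_neg hpos.le, ← div_eq_mul_inv, le_div_iff₀ (by positivity)]
        linarith
      rw [hk, Set.indicator_of_mem ht, Set.indicator_of_mem this, ENNReal.ofReal_mul (by norm_num)]
      apply le_of_eq
      simp only [ENNReal.ofReal_ofNat]
      ring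
    calc _ ≤ _ := lintegral_mono hle
      _ = ENNReal.ofReal (T ^ (p - 2) / (p - 2)) * (4 * ‖h v‖ₑ ^ (2 : ℝ)) := by
          rw [lintegral_mul_const, lintegral_indicator measurableSet_Ioc,
            setLIntegral_rpow_Ioc hT0.le hp2]
          exact (measurable_id.pow_const _).ennreal_ofReal.indicator measurableSet_Ioc
      _ = _ := by
          rw [← ofReal_norm, ENNReal.ofReal_rpow_of_pos hpos, ENNReal.ofReal_rpow_of_pos hpos,
            ← ENNReal.ofReal_ofNat 4, ← ENNReal.ofReal_mul (by norm_num),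
            ← ENNReal.ofReal_mul (by positivity), ← ENNReal.ofReal_mul (by positivity), hT,
            Real.mul_rpow (by positivity) (by positivity), ← Real.rpow_mul hpos.le,
            show p / (p - 1) = -(1 / (p - 1)) * (p - 2) + 2 by field_simp; ring,
            Real.rpow_add hpos]
          congr 1
          ring
  calc ∫⁻ w, ‖𝓕 h w‖ₑ ^ p ≤ ENNReal.ofReal p * ∫⁻ t, ∫⁻ v, k (t, v) := by
        rw [hl, hlay]; gcongr
    _ = ENNReal.ofReal p * ∫⁻ v, ∫⁻ t, k (t, v) := by
        rw [lintegral_lintegral_swap (f := fun t v => k (t, v)) hkm.aemeasurable]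
    _ ≤ ENNReal.ofReal p * ∫⁻ v, ENNReal.ofReal (4 * (2 * a) ^ (p - 2) / (p - 2)) *
          ‖h v‖ₑ ^ (p / (p - 1)) := by
        gcongr with v; exact hinner v
    _ = _ := by
        rw [lintegral_const_mul _ (hm.enorm.pow_const _), ← hA, hAa,
          ENNReal.ofReal_rpow_of_pos ha0, ← ENNReal.ofReal_mul (by positivity),
          ← ENNReal.ofReal_mul (by positivity), ← ENNReal.ofReal_mul (by positivity),
          Real.mul_rpow (by norm_num) ha0.le, show p - 1 = (p - 2) + 1 by ring,
          Real.rpow_add ha0, Real.rpow_one]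
        congr 1
        ring

end HausdorffYoung

/-! ### Sub-mean value property and pointwise growth of entire functions -/

section Growth

variable {d : ℕ}

@[fun_prop]
theorem continuous_complexPoint_comp {α : Type*} [TopologicalSpace α] {f g : α → RSpace d}
    (hf : Continuous f) (hg : Continuous g) : Continuous fun a => complexPoint (f a) (g a) := by
  unfold complexPoint
  fun_prop

theorem complexPoint_add (x y x' y' : RSpace d) :
    complexPoint (x + x') (y + y') = complexPoint x y + complexPoint x' y' := by
  ext j; simp [complexPoint]; ring

theorem smul_complexPoint (r : ℝ) (x y : RSpace d) :
    (r : ℂ) • complexPoint x y = complexPoint (r • x) (r • y) := by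
  ext j; simp [complexPoint]; ring

theorem exists_eq_complexPoint (z : CSpace d) : ∃ x y : RSpace d, z = complexPoint x y :=
  ⟨WithLp.toLp 2 fun j => (z j).re, WithLp.toLp 2 fun j => (z j).im, by
    ext j; simp [complexPoint]⟩

instance isAddHaarMeasure_volume_prod :
    (volume : Measure (RSpace d × RSpace d)).IsAddHaarMeasure :=
  inferInstanceAs ((volume : Measure (RSpace d)).prod volume).IsAddHaarMeasure

/-- Multiplication by `exp (iθ)` on `ℂ^d`, in real coordinates. -/
noncomputable def phaseRotation (d : ℕ) (θ : ℝ) : RSpace d × RSpace d →ₗ[ℝ] RSpace d × RSpace d :=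
  LinearMap.prod (Real.cos θ • LinearMap.fst ℝ _ _ - Real.sin θ • LinearMap.snd ℝ _ _)
    (Real.sin θ • LinearMap.fst ℝ _ _ + Real.cos θ • LinearMap.snd ℝ _ _)

theorem phaseRotation_apply (θ : ℝ) (q : RSpace d × RSpace d) :
    phaseRotation d θ q = (Real.cos θ • q.1 - Real.sin θ • q.2, Real.sin θ • q.1 + Real.cos θ • q.2) :=
  rfl

theorem complexPoint_phaseRotation (θ : ℝ) (q : RSpace d × RSpace d) :
    complexPoint (phaseRotation d θ q).1 (phaseRotation d θ q).2 =
      Complex.exp (θ * Complex.I) • complexPoint q.1 q.2 := by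
  ext j
  simp only [phaseRotation_apply, complexPoint, PiLp.sub_apply, PiLp.smul_apply, PiLp.add_apply,
    smul_eq_mul, Complex.exp_mul_I, ← Complex.ofReal_cos, ← Complex.ofReal_sin]
  push_cast
  linear_combination (Complex.sin θ * (q.2 j)) * Complex.I_mul_I.symm

theorem norm_sq_phaseRotation (θ : ℝ) (q : RSpace d × RSpace d) :
    ‖(phaseRotation d θ q).1‖ ^ 2 + ‖(phaseRotation d θ q).2‖ ^ 2 = ‖q.1‖ ^ 2 + ‖q.2‖ ^ 2 := by
  simp only [EuclideanSpace.norm_sq_eq, ← Finset.sum_add_distrib]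
  refine Finset.sum_congr rfl fun j _ => ?_
  simp only [phaseRotation_apply, PiLp.sub_apply, PiLp.smul_apply, PiLp.add_apply, smul_eq_mul,
    Real.norm_eq_abs, sq_abs]
  linear_combination (q.1 j ^ 2 + q.2 j ^ 2) * Real.sin_sq_add_cos_sq θ

/-- Conjugation by `(x, y) ↦ (x, -y)` turns the rotation by `θ` into its inverse, so the determinant
equals its own reciprocal. -/
theorem abs_det_phaseRotation (θ : ℝ) : |LinearMap.det (phaseRotation d θ)| = 1 := by
  set c : RSpace d × RSpace d →ₗ[ℝ] RSpace d × RSpace d :=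
    (LinearMap.fst ℝ _ _).prod (-LinearMap.snd ℝ _ _)
  have hc : c * c = 1 := by
    ext q <;> simp [c]
  have hinv : phaseRotation d θ * phaseRotation d (-θ) = 1 := by
    refine LinearMap.ext fun q => Prod.ext ?_ ?_ <;> ext j <;>
      simp [phaseRotation_apply]
    · linear_combination q.1 j * Real.sin_sq_add_cos_sq θ
    · linear_combination q.2 j * Real.sin_sq_add_cos_sq θ
  have hconj : phaseRotation d (-θ) = c * phaseRotation d θ * c := by
    refine LinearMap.ext fun q => Prod.ext ?_ ?_ <;> ext j <;>
      simp [phaseRotation_apply, c, add_comm]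
  have h1 := congrArg LinearMap.det hinv
  have h2 := congrArg LinearMap.det hc
  rw [hconj] at h1
  simp only [map_mul, map_one] at h1 h2
  have : LinearMap.det (phaseRotation d θ) ^ 2 = 1 := by
    linear_combination h1 - LinearMap.det (phaseRotation d θ) ^ 2 * h2
  rcases sq_eq_one_iff.1 this with h | h <;> simp [h]

theorem measurePreserving_phaseRotation (θ : ℝ) : MeasurePreserving (phaseRotation d θ) := by
  refine ⟨(LinearMap.continuous_of_finiteDimensional _).measurable, ?_⟩
  have h := abs_det_phaseRotation (d := d) θ
  rw [Measure.map_linearMap_addHaar_eq_smul_addHaar _ (by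
    intro h0; rw [h0] at h; simp at h), abs_inv, h]
  simp

theorem enorm_le_lintegral_circle {F : CSpace d → ℂ} (hF : Differentiable ℂ F) (z w : CSpace d) :
    ENNReal.ofReal (2 * Real.pi) * ‖F z‖ₑ ≤
      ∫⁻ θ in Set.Ioc 0 (2 * Real.pi), ‖F (z + Complex.exp (θ * Complex.I) • w)‖ₑ := by
  have hf : Differentiable ℂ fun t : ℂ => F (z + t • w) := by fun_prop
  have h := (hf.diffContOnCl (s := Metric.ball 0 |1|)).circleAverage
  simp only [zero_smul, add_zero, Real.circleAverage_def, circleMap, Complex.ofReal_one, zero_add,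
    one_mul] at h
  rw [← h, enorm_smul, intervalIntegral.integral_of_le Real.two_pi_pos.le,
    Real.enorm_of_nonneg (by positivity), ← mul_assoc, ← ENNReal.ofReal_mul (by positivity),
    mul_inv_cancel₀ (by positivity), ENNReal.ofReal_one, one_mul]
  exact enorm_integral_le_lintegral_enorm _

/-- The sub-mean value property of an entire function over a ball of `ℂ^d`. -/
theorem volume_ball_mul_enorm_le {F : CSpace d → ℂ} (hF : Differentiable ℂ F) (z : CSpace d) :
    volume {q : RSpace d × RSpace d | ‖q.1‖ ^ 2 + ‖q.2‖ ^ 2 ≤ 1} * ‖F z‖ₑ ≤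
      ∫⁻ q in {q : RSpace d × RSpace d | ‖q.1‖ ^ 2 + ‖q.2‖ ^ 2 ≤ 1},
        ‖F (z + complexPoint q.1 q.2)‖ₑ := by
  set B : Set (RSpace d × RSpace d) := {q | ‖q.1‖ ^ 2 + ‖q.2‖ ^ 2 ≤ 1} with hB
  have hBm : MeasurableSet B := (isClosed_le (by fun_prop) (by fun_prop)).measurableSet
  have hFc := hF.continuous
  have hpos : 0 < 2 * Real.pi := Real.two_pi_pos
  -- The ball is a union of circles `e^{iθ}w`: averaging the one-variable mean value inequality over
  -- `w` in the ball and swapping integrals, every angle gives the same integral, so polar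
  -- coordinates are not needed.
  have hrot : ∀ θ : ℝ, ∫⁻ q in B, ‖F (z + Complex.exp (θ * Complex.I) • complexPoint q.1 q.2)‖ₑ =
      ∫⁻ q in B, ‖F (z + complexPoint q.1 q.2)‖ₑ := by
    intro θ
    have hpre : phaseRotation d θ ⁻¹' B = B := by
      ext q; simp only [hB, Set.mem_preimage, Set.mem_ofPred_eq, norm_sq_phaseRotation]
    have := (measurePreserving_phaseRotation (d := d) θ).setLIntegral_comp_preimage hBm
      (f := fun q => ‖F (z + complexPoint q.1 q.2)‖ₑ)
      (Continuous.measurable (by fun_prop))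
    rw [hpre] at this
    simpa only [complexPoint_phaseRotation] using this
  have h2 : ENNReal.ofReal (2 * Real.pi) * (volume B * ‖F z‖ₑ) ≤
      ENNReal.ofReal (2 * Real.pi) * ∫⁻ q in B, ‖F (z + complexPoint q.1 q.2)‖ₑ := by
    calc _ = ∫⁻ _ in B, ENNReal.ofReal (2 * Real.pi) * ‖F z‖ₑ := by
          rw [setLIntegral_const]; ring
      _ ≤ ∫⁻ q in B, ∫⁻ θ in Set.Ioc 0 (2 * Real.pi),
            ‖F (z + Complex.exp (θ * Complex.I) • complexPoint q.1 q.2)‖ₑ := by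
          gcongr with q
          exact enorm_le_lintegral_circle hF _ _
      _ = ∫⁻ θ in Set.Ioc 0 (2 * Real.pi), ∫⁻ q in B,
            ‖F (z + Complex.exp (θ * Complex.I) • complexPoint q.1 q.2)‖ₑ := by
          rw [lintegral_lintegral_swap]
          refine (Continuous.measurable ?_).aemeasurable
          unfold Function.uncurry
          fun_prop
      _ = _ := by
          simp only [hrot]
          rw [setLIntegral_const, Real.volume_Ioc, sub_zero, mul_comm]
  exact (ENNReal.mul_le_mul_iff_right (ENNReal.ofReal_pos.2 hpos).ne' ENNReal.ofReal_ne_top).1 h2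

/-- Entire functions on `ℂ^d` of strictly smaller growth than `exp (|z|² / 2)`. -/
structure IsSubGaussian (F : CSpace d → ℂ) : Prop where
  differentiable : Differentiable ℂ F
  exists_bound : ∃ a C : ℝ, 0 < a ∧ a < 1 ∧ 0 ≤ C ∧ ∀ x y : RSpace d,
    ‖F (complexPoint x y)‖ ≤ C * Real.exp (a * (‖x‖ ^ 2 + ‖y‖ ^ 2) / 2)

/-- The weight of the range space of the Segal-Bargmann transform. -/
noncomputable def rangeWeight (b : ℝ) (q : RSpace d × RSpace d) : ℝ :=
  Real.exp (-(‖q.2‖ ^ 2 / 2)) * Real.exp (-(‖q.1‖ ^ 2 * b / 2))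

/-- The sub-mean value property on the unit ball about the point; since `b ≤ 1`, the weight there is
at least the reciprocal of the exponential in the bound. The quadratic rate is critical, which is
why dilation is needed afterwards. -/
theorem exists_pointwise_bound {F : CSpace d → ℂ} (hF : Differentiable ℂ F) {b s : ℝ}
    (hb1 : b ≤ 1) (hs : 1 ≤ s)
    (hint : ∫⁻ q : RSpace d × RSpace d,
      ‖F (complexPoint q.1 q.2) * (rangeWeight b q : ℂ)‖ₑ ^ s < ⊤) :
    ∃ C : ℝ, 0 ≤ C ∧ ∀ x y : RSpace d,
      ‖F (complexPoint x y)‖ ≤ C * Real.exp (((‖x‖ + 1) ^ 2 + (‖y‖ + 1) ^ 2) / 2) := by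
  set B : Set (RSpace d × RSpace d) := {q | ‖q.1‖ ^ 2 + ‖q.2‖ ^ 2 ≤ 1} with hB
  have hBm : MeasurableSet B := (isClosed_le (by fun_prop) (by fun_prop)).measurableSet
  set N := ∫⁻ q : RSpace d × RSpace d, ‖F (complexPoint q.1 q.2) * (rangeWeight b q : ℂ)‖ₑ ^ s
  have hFc := hF.continuous
  have hW : Continuous (rangeWeight (d := d) b) := by unfold rangeWeight; fun_prop
  have hBtop : volume B ≠ ⊤ := by
    have : B ⊆ Metric.closedBall 0 1 := by
      rintro ⟨x, y⟩ hq
      have hq' : ‖x‖ ^ 2 + ‖y‖ ^ 2 ≤ 1 := hq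
      rw [mem_closedBall_zero_iff, Prod.norm_mk]
      exact max_le (by nlinarith [norm_nonneg x, norm_nonneg y])
        (by nlinarith [norm_nonneg x, norm_nonneg y])
    exact ((measure_mono this).trans_lt measure_closedBall_lt_top).ne
  have hB0 : volume B ≠ 0 := by
    have hnhds : B ∈ nhds (0 : RSpace d × RSpace d) := by
      have : Continuous fun q : RSpace d × RSpace d => ‖q.1‖ ^ 2 + ‖q.2‖ ^ 2 := by fun_prop
      exact this.continuousAt.eventually (ge_mem_nhds (by simp)) 
    exact (Measure.measure_pos_of_mem_nhds _ hnhds).ne'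
  refine ⟨((volume B)⁻¹ * (volume B + N)).toReal, ENNReal.toReal_nonneg, fun x y => ?_⟩
  set M := Real.exp (((‖x‖ + 1) ^ 2 + (‖y‖ + 1) ^ 2) / 2) with hM
  have hstep : volume B * ‖F (complexPoint x y)‖ₑ ≤ (volume B + N) * ENNReal.ofReal M := by
    refine (volume_ball_mul_enorm_le hF _).trans ?_
    calc _ ≤ ∫⁻ q in B, (1 + ‖F (complexPoint (x + q.1) (y + q.2)) *
            (rangeWeight b ((x, y) + q) : ℂ)‖ₑ ^ s) * ENNReal.ofReal M := by
          refine setLIntegral_mono' hBm fun q hq => ?_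
          have hq' : ‖q.1‖ ^ 2 + ‖q.2‖ ^ 2 ≤ 1 := hq
          have h1 : ‖q.1‖ ≤ 1 := by nlinarith [norm_nonneg q.1, norm_nonneg q.2]
          have h2 : ‖q.2‖ ≤ 1 := by nlinarith [norm_nonneg q.1, norm_nonneg q.2]
          have h3 : ‖x + q.1‖ ≤ ‖x‖ + 1 := (norm_add_le _ _).trans (by linarith)
          have h4 : ‖y + q.2‖ ≤ ‖y‖ + 1 := (norm_add_le _ _).trans (by linarith)
          have hone : 1 ≤ rangeWeight b ((x, y) + q) * M := by
            rw [rangeWeight, hM, ← Real.exp_add, ← Real.exp_add, Real.one_le_exp_iff]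
            have h5 : ‖x + q.1‖ ^ 2 ≤ (‖x‖ + 1) ^ 2 := by gcongr
            have h6 : ‖y + q.2‖ ^ 2 ≤ (‖y‖ + 1) ^ 2 := by gcongr
            have h7 : ‖x + q.1‖ ^ 2 * b ≤ ‖x + q.1‖ ^ 2 := mul_le_of_le_one_right (by positivity) hb1
            simp only [Prod.fst_add, Prod.snd_add]
            linarith
          rw [← complexPoint_add]
          set v := F (complexPoint (x + q.1) (y + q.2))
          calc ‖v‖ₑ = ‖v‖ₑ * 1 := (mul_one _).symm
            _ ≤ ‖v‖ₑ * ENNReal.ofReal (rangeWeight b ((x, y) + q) * M) := by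
                gcongr
                exact ENNReal.one_le_ofReal.2 hone
            _ = ‖v * (rangeWeight b ((x, y) + q) : ℂ)‖ₑ * ENNReal.ofReal M := by
                have hw : 0 ≤ rangeWeight b ((x, y) + q) := by unfold rangeWeight; positivity
                rw [ENNReal.ofReal_mul hw, enorm_mul, mul_assoc, ← ofReal_norm (rangeWeight b ((x, y) + q) : ℂ),
                  Complex.norm_of_nonneg hw]
            _ ≤ _ := by
                gcongr
                -- `t ≤ 1 + t^s` for `s ≥ 1` takes the place of Hölder on the ball.
                rcases le_total ‖v * (rangeWeight b ((x, y) + q) : ℂ)‖ₑ 1 with h | h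
                · exact h.trans le_self_add
                · exact (ENNReal.le_rpow_self_of_one_le h hs).trans le_add_self
      _ = (volume B + ∫⁻ q in B, ‖F (complexPoint (x + q.1) (y + q.2)) *
            (rangeWeight b ((x, y) + q) : ℂ)‖ₑ ^ s) * ENNReal.ofReal M := by
          rw [lintegral_mul_const _ (by fun_prop), lintegral_add_left measurable_const,
            setLIntegral_one]
      _ ≤ _ := by
          gcongr
          refine (setLIntegral_le_lintegral _ _).trans (le_of_eq ?_)
          exact lintegral_add_left_eq_self
            (fun q : RSpace d × RSpace d =>
              ‖F (complexPoint q.1 q.2) * (rangeWeight b q : ℂ)‖ₑ ^ s) (x, y)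
  have hfin : (volume B)⁻¹ * (volume B + N) ≠ ⊤ :=
    ENNReal.mul_ne_top (ENNReal.inv_ne_top.2 hB0) (ENNReal.add_ne_top.2 ⟨hBtop, hint.ne⟩)
  have hfinal : ENNReal.ofReal ‖F (complexPoint x y)‖ ≤
      ENNReal.ofReal (((volume B)⁻¹ * (volume B + N)).toReal * M) := by
    rw [ENNReal.ofReal_mul ENNReal.toReal_nonneg, ENNReal.ofReal_toReal hfin, ofReal_norm, mul_assoc]
    rwa [← ENNReal.mul_le_iff_le_inv hB0 hBtop]
  exact (ENNReal.ofReal_le_ofReal_iff (by positivity)).1 hfinal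

/-- Dilation multiplies the quadratic rate by `r²`; the room between `r²` and `(1 + r²)/2 < 1`
absorbs the linear terms by completing the square. -/
theorem isSubGaussian_comp_smul {F : CSpace d → ℂ} (hF : Differentiable ℂ F) {C : ℝ} (hC : 0 ≤ C)
    (hb : ∀ x y : RSpace d,
      ‖F (complexPoint x y)‖ ≤ C * Real.exp (((‖x‖ + 1) ^ 2 + (‖y‖ + 1) ^ 2) / 2))
    {r : ℝ} (hr : 0 < r) (hr1 : r < 1) : IsSubGaussian fun z => F ((r : ℂ) • z) := by
  refine ⟨by fun_prop, (1 + r ^ 2) / 2, C * Real.exp (1 + 2 * r ^ 2 / (1 - r ^ 2)), by positivity,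
    by nlinarith, by positivity, fun x y => ?_⟩
  have hd : 0 < 1 - r ^ 2 := by nlinarith
  have key : ∀ t : ℝ, (r * t + 1) ^ 2 ≤ (1 + r ^ 2) / 2 * t ^ 2 + (1 + 2 * r ^ 2 / (1 - r ^ 2)) := by
    intro t
    have : (1 + r ^ 2) / 2 * t ^ 2 + (1 + 2 * r ^ 2 / (1 - r ^ 2)) - (r * t + 1) ^ 2 =
        ((1 - r ^ 2) * t - 2 * r) ^ 2 / (2 * (1 - r ^ 2)) := by
      field_simp
      ring
    have h2 : 0 ≤ ((1 - r ^ 2) * t - 2 * r) ^ 2 / (2 * (1 - r ^ 2)) := by positivity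
    linarith
  refine (by simpa only [smul_complexPoint] using hb (r • x) (r • y) : _ ≤ _).trans ?_
  rw [mul_assoc, ← Real.exp_add, norm_smul, norm_smul, Real.norm_of_nonneg hr.le]
  gcongr
  linarith [key ‖x‖, key ‖y‖]

end Growth

/-! ### Contour shift, the inverse transform and Fourier inversion -/

section Inverse

variable {d : ℕ}

theorem sum_sq_complexPoint (x y : RSpace d) :
    ∑ j, complexPoint x y j ^ 2 =
      ((‖x‖ ^ 2 - ‖y‖ ^ 2 : ℝ) : ℂ) + 2 * ((inner ℝ x y : ℝ) : ℂ) * Complex.I := by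
  simp only [EuclideanSpace.norm_sq_eq, PiLp.inner_apply, complexPoint, RCLike.inner_apply,
    conj_trivial, Real.norm_eq_abs, sq_abs]
  push_cast
  rw [← Finset.sum_sub_distrib, Finset.mul_sum, Finset.sum_mul, ← Finset.sum_add_distrib]
  refine Finset.sum_congr rfl fun j _ => ?_
  linear_combination ((y j : ℂ)) ^ 2 * Complex.I_mul_I

theorem complexPoint_sub (x y x' y' : RSpace d) :
    complexPoint (x - x') (y - y') = complexPoint x y - complexPoint x' y' := by
  ext j; simp [complexPoint]; ring

theorem smul_complexPoint_complex (t : ℂ) (v : RSpace d) :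
    t • complexPoint v 0 = complexPoint (t.re • v) (t.im • v) := by
  ext j
  simp [complexPoint]
  conv_lhs => rw [← Complex.re_add_im t]
  ring

theorem integrable_exp_neg_mul_norm_sq_add {c : ℝ} (hc : 0 < c) (w : RSpace d) :
    Integrable fun y : RSpace d => Real.exp (-c * ‖y‖ ^ 2 + inner ℝ w y) := by
  have := (GaussianFourier.integrable_cexp_neg_mul_sq_norm_add (V := RSpace d) (b := (c : ℂ))
    (by simpa using hc) 1 w).norm
  refine this.congr (Filter.Eventually.of_forall fun y => ?_)
  simp [Complex.norm_exp, ← Complex.ofReal_pow]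

theorem integrable_exp_neg_mul_norm_sq {c : ℝ} (hc : 0 < c) :
    Integrable fun y : RSpace d => Real.exp (-c * ‖y‖ ^ 2) := by
  simpa using integrable_exp_neg_mul_norm_sq_add (d := d) hc 0

/-- For an entire function with Gaussian decay in the imaginary directions, the integral over
`x + i ℝ^d` does not depend on `x`. -/
theorem integral_complexPoint_eq {G : CSpace d → ℂ} (hG : Differentiable ℂ G) {c : ℝ} (hc : 0 < c)
    (hb : ∀ R : ℝ, ∃ K : ℝ, ∀ x y : RSpace d, ‖x‖ ≤ R →
      ‖G (complexPoint x y)‖ ≤ K * Real.exp (-c * ‖y‖ ^ 2)) (x x' : RSpace d) :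
    ∫ y, G (complexPoint x y) = ∫ y, G (complexPoint x' y) := by
  have hGc := hG.continuous
  set v := x' - x with hv
  set g : ℂ → RSpace d → ℂ := fun t y => G (complexPoint x y + t • complexPoint v 0) with hg
  have hgd : ∀ y, Differentiable ℂ fun t => g t y := fun y => by simp only [hg]; fun_prop
  have hgc : ∀ t, Continuous (g t) := fun t => by simp only [hg]; fun_prop
  have hgcp : ∀ t y, g t y = G (complexPoint (x + t.re • v) (y + t.im • v)) := by
    intro t y
    rw [complexPoint_add, ← smul_complexPoint_complex]
  -- Half of the decay rate is given up to absorb the bounded translation of `y` by `t.im • v`.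
  have hbd : ∀ ρ : ℝ, 0 ≤ ρ → ∃ K : ℝ, ∀ (t : ℂ) (y : RSpace d), ‖t‖ ≤ ρ →
      ‖g t y‖ ≤ K * Real.exp (-(c / 2) * ‖y‖ ^ 2) := by
    intro ρ hρ
    obtain ⟨K, hK⟩ := hb (‖x‖ + ρ * ‖v‖)
    refine ⟨K * Real.exp (c * (ρ * ‖v‖) ^ 2), fun t y ht => ?_⟩
    have h1 : ‖x + t.re • v‖ ≤ ‖x‖ + ρ * ‖v‖ := by
      refine (norm_add_le _ _).trans ?_
      rw [norm_smul, Real.norm_eq_abs]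
      gcongr
      exact (Complex.abs_re_le_norm t).trans ht
    have h2 : ‖t.im • v‖ ≤ ρ * ‖v‖ := by
      rw [norm_smul, Real.norm_eq_abs]
      gcongr
      exact (Complex.abs_im_le_norm t).trans ht
    have h3 : ‖y‖ ≤ ‖y + t.im • v‖ + ρ * ‖v‖ := by
      have := norm_sub_le (y + t.im • v) (t.im • v)
      rw [add_sub_cancel_right] at this
      linarith
    have hKpos : 0 ≤ K := by
      have := (norm_nonneg _).trans (hK _ (y + t.im • v) h1)
      exact nonneg_of_mul_nonneg_left this (Real.exp_pos _)
    rw [hgcp, mul_assoc, ← Real.exp_add]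
    refine (hK _ _ h1).trans ?_
    gcongr
    have h4 : ‖y‖ ^ 2 ≤ (‖y + t.im • v‖ + ρ * ‖v‖) ^ 2 := by gcongr
    nlinarith [mul_nonneg hc.le (sq_nonneg (‖y + t.im • v‖ - ρ * ‖v‖)),
      mul_le_mul_of_nonneg_left h4 hc.le]
  have hint : ∀ t, Integrable (g t) := by
    intro t
    obtain ⟨K, hK⟩ := hbd ‖t‖ (norm_nonneg _)
    exact ((integrable_exp_neg_mul_norm_sq (half_pos hc)).const_mul K).mono'
      (hgc t).aestronglyMeasurable (Filter.Eventually.of_forall fun y => hK t y le_rfl)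
  -- `φ` is entire and, by translation invariance in `y`, constant along imaginary directions; hence
  -- its derivative vanishes and `φ 0 = φ 1`, the two integrals to be compared.
  set φ : ℂ → ℂ := fun t => ∫ y, g t y with hφ
  have hφd : Differentiable ℂ φ := by
    intro t
    obtain ⟨K, hK⟩ := hbd (‖t‖ + 2) (by positivity)
    refine (hasDerivAt_integral_of_dominated_loc_of_deriv_le (μ := volume)
      (F := g) (F' := fun s y => deriv (fun s => g s y) s)
      (bound := fun y => K * Real.exp (-(c / 2) * ‖y‖ ^ 2))
      (Metric.ball_mem_nhds t one_pos)
      (Filter.Eventually.of_forall fun s => (hgc s).aestronglyMeasurable) (hint t) ?_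
      (Filter.Eventually.of_forall fun y s hs => ?_)
      ((integrable_exp_neg_mul_norm_sq (half_pos hc)).const_mul K)
      (Filter.Eventually.of_forall fun y s _ =>
        (hgd y s).hasDerivAt)).2.differentiableAt
    · have hu : Continuous (Function.uncurry fun y s => g s y) := by
        simp only [hg]
        unfold Function.uncurry
        fun_prop
      exact ((stronglyMeasurable_deriv_with_param hu).comp_measurable
        (measurable_id.prodMk measurable_const)).aestronglyMeasurable
    · have hs' : ‖s - t‖ < 1 := by simpa [dist_eq_norm] using hs
      have := Complex.norm_deriv_le_of_forall_mem_sphere_norm_le (f := fun s => g s y) (c := s)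
        one_pos (hgd y).diffContOnCl (C := K * Real.exp (-(c / 2) * ‖y‖ ^ 2)) fun w hw => by
          refine hK w y ?_
          have hw' : ‖w - s‖ = 1 := by simpa [dist_eq_norm] using hw
          calc ‖w‖ = ‖t + (s - t) + (w - s)‖ := by congr 1; ring
            _ ≤ ‖t‖ + ‖s - t‖ + ‖w - s‖ := norm_add₃_le
            _ ≤ ‖t‖ + 2 := by linarith
      simpa using this
  have hφinv : ∀ (t : ℂ) (s : ℝ), φ (t + s * Complex.I) = φ t := by
    intro t s
    simp only [hφ, hgcp]
    have := integral_add_right_eq_self (μ := (volume : Measure (RSpace d)))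
      (fun y => G (complexPoint (x + t.re • v) (y + t.im • v))) (s • v)
    rw [← this]
    simp only [Complex.add_re, Complex.mul_re, Complex.ofReal_re, Complex.I_re, mul_zero,
      Complex.ofReal_im, Complex.I_im, mul_one, sub_self, add_zero, Complex.add_im, Complex.mul_im,
      add_zero]
    refine integral_congr_ae (Filter.Eventually.of_forall fun y => ?_)
    simp only [add_smul]
    congr 2
    abel
  have hφ0 : ∀ t, deriv φ t = 0 := by
    intro t
    have h1 : HasDerivAt (fun s : ℝ => t + s * Complex.I) Complex.I 0 := by
      simpa using ((Complex.ofRealCLM.hasDerivAt (x := 0)).mul_const Complex.I).const_add t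
    have h2 : HasDerivAt φ (deriv φ t) (t + ((0 : ℝ) : ℂ) * Complex.I) := by
      simpa using (hφd t).hasDerivAt
    have h3 := h2.scomp (0 : ℝ) h1
    have h4 : (φ ∘ fun s : ℝ => t + s * Complex.I) = fun _ => φ t := funext fun s => hφinv t s
    rw [h4] at h3
    have := h3.unique (hasDerivAt_const (0 : ℝ) (φ t))
    simpa using this
  have := is_const_of_deriv_eq_zero hφd hφ0 0 1
  simpa [hφ, hg, hv, ← complexPoint_add] using this

/-- The inverse of the Segal-Bargmann transform, on functions of small growth. -/
noncomputable def sbInverse (F : CSpace d → ℂ) (u : RSpace d) : ℂ :=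
  (((2 * Real.pi) ^ (-(d : ℝ) / 2) : ℝ) : ℂ) *
    ∫ y, F (complexPoint u y) * (Real.exp (-(‖y‖ ^ 2 / 2)) : ℂ)

/-- The function of `y` whose Fourier transform is a Gaussian multiple of `sbInverse F`. -/
noncomputable def fiber (F : CSpace d → ℂ) (x y : RSpace d) : ℂ :=
  F (complexPoint x y) * (Real.exp (-(‖y‖ ^ 2 / 2)) : ℂ) * Complex.exp (inner ℝ x y * Complex.I)

theorem norm_fiber (F : CSpace d → ℂ) (x y : RSpace d) :
    ‖fiber F x y‖ = ‖F (complexPoint x y)‖ * Real.exp (-(‖y‖ ^ 2 / 2)) := by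
  rw [fiber, norm_mul, norm_mul, Complex.norm_exp_ofReal_mul_I, mul_one,
    Complex.norm_of_nonneg (Real.exp_pos _).le]

namespace IsSubGaussian

variable {F G : CSpace d → ℂ}

theorem sub (hF : IsSubGaussian F) (hG : IsSubGaussian G) :
    IsSubGaussian fun z => F z - G z := by
  obtain ⟨a, C, ha, ha1, hC, h⟩ := hF.exists_bound
  obtain ⟨b, D, hb, hb1, hD, h'⟩ := hG.exists_bound
  refine ⟨hF.differentiable.sub hG.differentiable, max a b, C + D, lt_max_of_lt_left ha,
    max_lt ha1 hb1, by positivity, fun x y => ?_⟩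
  refine (norm_sub_le _ _).trans ?_
  rw [add_mul]
  refine add_le_add ((h x y).trans ?_) ((h' x y).trans ?_) <;> gcongr
  · exact le_max_left _ _
  · exact le_max_right _ _

theorem continuous_fiber (hF : IsSubGaussian F) (x : RSpace d) : Continuous (fiber F x) := by
  have := hF.differentiable.continuous
  unfold fiber
  fun_prop

theorem integrable_fiber (hF : IsSubGaussian F) (x : RSpace d) : Integrable (fiber F x) := by
  obtain ⟨a, C, ha, ha1, hC, h⟩ := hF.exists_bound
  refine ((integrable_exp_neg_mul_norm_sq (c := (1 - a) / 2) (by linarith)).const_mul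
    (C * Real.exp (a * ‖x‖ ^ 2 / 2))).mono' (hF.continuous_fiber x).aestronglyMeasurable
    (Filter.Eventually.of_forall fun y => ?_)
  rw [norm_fiber]
  calc _ ≤ C * Real.exp (a * (‖x‖ ^ 2 + ‖y‖ ^ 2) / 2) * Real.exp (-(‖y‖ ^ 2 / 2)) := by
        gcongr; exact h x y
    _ = _ := by
        rw [mul_assoc, mul_assoc, ← Real.exp_add, ← Real.exp_add]
        ring_nf

theorem integrable_inverse (hF : IsSubGaussian F) (x : RSpace d) :
    Integrable fun y => F (complexPoint x y) * (Real.exp (-(‖y‖ ^ 2 / 2)) : ℂ) := by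
  have hc := hF.differentiable.continuous
  refine (hF.integrable_fiber x).mono (Continuous.aestronglyMeasurable (by fun_prop))
    (Filter.Eventually.of_forall fun y => le_of_eq ?_)
  rw [norm_fiber, norm_mul, Complex.norm_of_nonneg (Real.exp_pos _).le]

theorem sbInverse_sub (hF : IsSubGaussian F) (hG : IsSubGaussian G) (u : RSpace d) :
    sbInverse (fun z => F z - G z) u = sbInverse F u - sbInverse G u := by
  simp only [sbInverse, sub_mul]
  rw [integral_sub (hF.integrable_inverse u) (hG.integrable_inverse u), mul_sub]

theorem exists_norm_sbInverse_le (hF : IsSubGaussian F) :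
    ∃ a C : ℝ, a < 1 ∧ 0 ≤ C ∧ ∀ u, ‖sbInverse F u‖ ≤ C * Real.exp (a * ‖u‖ ^ 2 / 2) := by
  obtain ⟨a, C, ha, ha1, hC, h⟩ := hF.exists_bound
  have hi := integrable_exp_neg_mul_norm_sq (d := d) (c := (1 - a) / 2) (by linarith)
  refine ⟨a, (2 * Real.pi) ^ (-(d : ℝ) / 2) *
    (C * ∫ y : RSpace d, Real.exp (-((1 - a) / 2) * ‖y‖ ^ 2)), ha1, ?_, fun u => ?_⟩
  · have : 0 ≤ ∫ y : RSpace d, Real.exp (-((1 - a) / 2) * ‖y‖ ^ 2) :=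
      integral_nonneg fun y => (Real.exp_pos _).le
    positivity
  rw [sbInverse, norm_mul, Complex.norm_of_nonneg (by positivity), mul_assoc]
  gcongr
  rw [mul_right_comm, ← integral_const_mul]
  refine norm_integral_le_of_norm_le (hi.const_mul _) (Filter.Eventually.of_forall fun y => ?_)
  rw [norm_mul, Complex.norm_of_nonneg (Real.exp_pos _).le]
  calc _ ≤ C * Real.exp (a * (‖u‖ ^ 2 + ‖y‖ ^ 2) / 2) * Real.exp (-(‖y‖ ^ 2 / 2)) := by
        gcongr; exact h u y
    _ = _ := by
        rw [mul_assoc, mul_assoc, ← Real.exp_add, ← Real.exp_add]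
        ring_nf

/-- Up to constants and scaling, `exp (-|x - u|² / 2) * sbInverse F u` is the Fourier transform of
`fiber F x`, for every `x`. -/
theorem fourier_fiber (hF : IsSubGaussian F) (x u : RSpace d) :
    (((2 * Real.pi) ^ (-(d : ℝ) / 2) : ℝ) : ℂ) * 𝓕 (fiber F x) ((2 * Real.pi)⁻¹ • u) =
      sbInverse F u * (Real.exp (-(‖x - u‖ ^ 2 / 2)) : ℂ) := by
  obtain ⟨a, C, ha, ha1, hC, h⟩ := hF.exists_bound
  -- On `Re z = u` this is the integrand of `sbInverse F u`; on `Re z = x` it is `e^{|x-u|²/2}`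
  -- times the Fourier integrand of `fiber F x`. The rate `a < 1` leaves Gaussian decay in `y` for
  -- the shift.
  set G : CSpace d → ℂ := fun z => F z * Complex.exp ((∑ j, (z - complexPoint u 0) j ^ 2) / 2)
    with hG
  have hGd : Differentiable ℂ G := by
    have := hF.differentiable
    simp only [hG, PiLp.sub_apply]
    fun_prop
  have hGv : ∀ x y, G (complexPoint x y) = F (complexPoint x y) *
      Complex.exp ((((‖x - u‖ ^ 2 - ‖y‖ ^ 2 : ℝ) : ℂ) +
        2 * ((inner ℝ (x - u) y : ℝ) : ℂ) * Complex.I) / 2) := by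
    intro x y
    rw [← sum_sq_complexPoint]
    have : complexPoint (x - u) y = complexPoint x y - complexPoint u 0 := by
      rw [← complexPoint_sub, sub_zero]
    rw [this]
  have hshift := integral_complexPoint_eq hGd (c := (1 - a) / 2) (by linarith) (fun R => by
    refine ⟨C * Real.exp (a * R ^ 2 / 2 + (R + ‖u‖) ^ 2 / 2), fun x y hx => ?_⟩
    rw [hGv, norm_mul, Complex.norm_exp]
    have hre : ((((‖x - u‖ ^ 2 - ‖y‖ ^ 2 : ℝ) : ℂ) +
        2 * ((inner ℝ (x - u) y : ℝ) : ℂ) * Complex.I) / 2).re = (‖x - u‖ ^ 2 - ‖y‖ ^ 2) / 2 := by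
      rw [← Complex.ofReal_ofNat, Complex.div_ofReal_re]
      simp [-Complex.ofReal_sub, -Complex.ofReal_pow]
    rw [hre]
    have h2 : ‖x - u‖ ^ 2 ≤ (R + ‖u‖) ^ 2 := by
      gcongr
      exact (norm_sub_le _ _).trans (by gcongr)
    have h3 : ‖x‖ ^ 2 ≤ R ^ 2 := by gcongr
    calc _ ≤ C * Real.exp (a * (‖x‖ ^ 2 + ‖y‖ ^ 2) / 2) *
            Real.exp ((‖x - u‖ ^ 2 - ‖y‖ ^ 2) / 2) := by gcongr; exact h x y
      _ ≤ _ := by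
        rw [mul_assoc, mul_assoc, ← Real.exp_add, ← Real.exp_add]
        refine mul_le_mul_of_nonneg_left (Real.exp_le_exp.2 ?_) hC
        nlinarith [mul_le_mul_of_nonneg_left h3 ha.le]) x u
  rw [sbInverse, mul_assoc, Real.fourier_eq', ← integral_mul_const]
  congr 1
  have h1 : ∀ y, Complex.exp (((-2 * Real.pi * inner ℝ y ((2 * Real.pi)⁻¹ • u) : ℝ) : ℂ) *
      Complex.I) • fiber F x y =
      G (complexPoint x y) * (Real.exp (-(‖x - u‖ ^ 2 / 2)) : ℂ) := by
    intro y
    rw [hGv, fiber, smul_eq_mul, inner_smul_right, inner_sub_left, real_inner_comm u y]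
    have hpi : (-2 * Real.pi * ((2 * Real.pi)⁻¹ * inner ℝ u y) : ℝ) = -inner ℝ u y := by
      field_simp
    rw [hpi]
    push_cast
    rw [mul_assoc (F (complexPoint x y)), mul_assoc (F (complexPoint x y)), mul_left_comm,
      ← Complex.exp_add, ← Complex.exp_add, ← Complex.exp_add]
    congr 2
    ring
  have h2 : ∀ y, F (complexPoint u y) * (Real.exp (-(‖y‖ ^ 2 / 2)) : ℂ) = G (complexPoint u y) := by
    intro y
    rw [hGv]
    simp [neg_div]
  simp only [h1, h2]
  rw [integral_mul_const, hshift, integral_mul_const]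

/-- The case `x = 0` of `fourier_fiber` writes it as an exponential times the Fourier transform of
an integrable function. -/
theorem continuous_sbInverse (hF : IsSubGaussian F) : Continuous (sbInverse F) := by
  have h : sbInverse F = fun u => (((2 * Real.pi) ^ (-(d : ℝ) / 2) : ℝ) : ℂ) *
      𝓕 (fiber F 0) ((2 * Real.pi)⁻¹ • u) * (Real.exp (‖u‖ ^ 2 / 2) : ℂ) := by
    ext u
    rw [hF.fourier_fiber 0 u, mul_assoc, ← Complex.ofReal_mul, ← Real.exp_add]
    simp
  have := continuous_fourier_of_integrable (hF.integrable_fiber 0)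
  rw [h]
  fun_prop

theorem integrable_sbInverse_mul (hF : IsSubGaussian F) (x : RSpace d) :
    Integrable fun u => sbInverse F u * (Real.exp (-(‖x - u‖ ^ 2 / 2)) : ℂ) := by
  obtain ⟨a, C, ha1, hC, h⟩ := hF.exists_norm_sbInverse_le
  have hc := hF.continuous_sbInverse
  refine ((integrable_exp_neg_mul_norm_sq_add (c := (1 - a) / 2) (by linarith) x).const_mul
    (C * Real.exp (-(‖x‖ ^ 2 / 2)))).mono' (Continuous.aestronglyMeasurable (by fun_prop))
    (Filter.Eventually.of_forall fun u => ?_)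
  rw [norm_mul, Complex.norm_of_nonneg (Real.exp_pos _).le]
  calc _ ≤ C * Real.exp (a * ‖u‖ ^ 2 / 2) * Real.exp (-(‖x - u‖ ^ 2 / 2)) := by
        gcongr; exact h u
    _ = _ := by
        rw [mul_assoc, mul_assoc, ← Real.exp_add, ← Real.exp_add, norm_sub_sq_real]
        ring_nf

/-- At `z = x + iy` the kernel is `e^{-|x-u|²/2} e^{i u·y}` up to factors free of `u`; by
`fourier_fiber` the integral over `u` is then Fourier inversion for `fiber F x`, evaluated at `y`.
-/
theorem segalBargmann_sbInverse (hF : IsSubGaussian F) : segalBargmann (sbInverse F) = F := by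
  ext z
  obtain ⟨x, y, rfl⟩ := exists_eq_complexPoint z
  set κ : ℝ := (2 * Real.pi) ^ (-(d : ℝ) / 2) with hκ
  have hκ2 : κ * κ * (2 * Real.pi) ^ d = 1 := by
    rw [hκ, ← Real.rpow_add Real.two_pi_pos, ← Real.rpow_natCast, ← Real.rpow_add Real.two_pi_pos]
    simp
  have hκ0 : κ ≠ 0 := by intro h; simp [h] at hκ2
  have hκc : (κ : ℂ) ≠ 0 := by exact_mod_cast hκ0
  have h1 : ∀ u, gaussianDensityC (complexPoint x y - complexPoint u 0) * sbInverse F u =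
      (κ : ℂ) * κ * (Real.exp (‖y‖ ^ 2 / 2) : ℂ) * Complex.exp (-(inner ℝ x y) * Complex.I) *
        (Complex.exp (inner ℝ u y * Complex.I) * 𝓕 (fiber F x) ((2 * Real.pi)⁻¹ • u)) := by
    intro u
    have h2 := hF.fourier_fiber x u
    rw [← hκ] at h2
    have h3 : ((‖x - u‖ ^ 2 - ‖y‖ ^ 2 : ℝ) : ℂ) + 2 * ((inner ℝ (x - u) y : ℝ) : ℂ) * Complex.I =
        ∑ j, (complexPoint x y - complexPoint u 0) j ^ 2 := by
      rw [← sum_sq_complexPoint, ← complexPoint_sub, sub_zero]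
    rw [gaussianDensityC, ← hκ, ← h3, inner_sub_left]
    have h4 : Complex.exp (-(((‖x - u‖ ^ 2 - ‖y‖ ^ 2 : ℝ) : ℂ) +
        2 * ((inner ℝ x y - inner ℝ u y : ℝ) : ℂ) * Complex.I) / 2) =
        (Real.exp (‖y‖ ^ 2 / 2) : ℂ) * Complex.exp (-(inner ℝ x y) * Complex.I) *
          Complex.exp (inner ℝ u y * Complex.I) * (Real.exp (-(‖x - u‖ ^ 2 / 2)) : ℂ) := by
      push_cast
      rw [← Complex.exp_add, ← Complex.exp_add, ← Complex.exp_add]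
      congr 1
      ring
    rw [h4]
    linear_combination -(κ * (Real.exp (‖y‖ ^ 2 / 2) : ℂ) *
      Complex.exp (-(inner ℝ x y) * Complex.I) * Complex.exp (inner ℝ u y * Complex.I)) * h2
  have hpi : (2 * Real.pi)⁻¹ ≠ 0 := inv_ne_zero Real.two_pi_pos.ne'
  -- Inversion needs an integrable transform: `fourier_fiber` expresses it through `sbInverse F`,
  -- whose growth rate `a < 1` is beaten by the Gaussian.
  have hFi : Integrable (𝓕 (fiber F x)) := by
    rw [← integrable_comp_smul_iff volume _ hpi]
    refine ((hF.integrable_sbInverse_mul x).const_mul ((κ : ℂ)⁻¹)).congr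
      (Filter.Eventually.of_forall fun u => ?_)
    simp only
    rw [← hF.fourier_fiber x u, ← hκ, inv_mul_cancel_left₀ hκc]
  have hinv := congrFun ((hF.continuous_fiber x).fourierInv_fourier_eq (hF.integrable_fiber x) hFi) y
  rw [Real.fourierInv_eq'] at hinv
  have hsc := Measure.integral_comp_smul (volume : Measure (RSpace d))
    (fun v => Complex.exp (((2 * Real.pi * inner ℝ v y : ℝ) : ℂ) * Complex.I) • 𝓕 (fiber F x) v)
    (2 * Real.pi)⁻¹
  rw [hinv, finrank_euclideanSpace_fin, inv_pow, inv_inv,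
    abs_of_pos (by positivity)] at hsc
  have hsc' : ∫ u, Complex.exp (inner ℝ u y * Complex.I) * 𝓕 (fiber F x) ((2 * Real.pi)⁻¹ • u) =
      ((2 * Real.pi) ^ d : ℝ) • fiber F x y := by
    rw [← hsc]
    refine integral_congr_ae (Filter.Eventually.of_forall fun u => ?_)
    simp only [smul_eq_mul, real_inner_smul_left]
    congr 4
    field_simp
  rw [segalBargmann]
  simp only [h1]
  rw [integral_const_mul, hsc', fiber, Complex.real_smul]
  have e1 : (Real.exp (‖y‖ ^ 2 / 2) : ℂ) * (Real.exp (-(‖y‖ ^ 2 / 2)) : ℂ) = 1 := by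
    rw [← Complex.ofReal_mul, ← Real.exp_add]; simp
  have e2 : Complex.exp (-(inner ℝ x y) * Complex.I) * Complex.exp (inner ℝ x y * Complex.I) = 1 := by
    rw [← Complex.exp_add]; simp
  have e3 : (κ : ℂ) * κ * ((2 * Real.pi) ^ d : ℝ) = 1 := by exact_mod_cast hκ2
  calc _ = F (complexPoint x y) * ((κ : ℂ) * κ * ((2 * Real.pi) ^ d : ℝ)) *
      ((Real.exp (‖y‖ ^ 2 / 2) : ℂ) * (Real.exp (-(‖y‖ ^ 2 / 2)) : ℂ)) *
      (Complex.exp (-(inner ℝ x y) * Complex.I) * Complex.exp (inner ℝ x y * Complex.I)) := by ring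
    _ = _ := by rw [e1, e2, e3]; ring

end IsSubGaussian

end Inverse

/-! ### From Hausdorff-Young on fibres to the bound for the inverse transform -/

section NormEstimate

/-- A reverse Minkowski inequality for exponents `b ≤ 1` and bounded kernels. -/
theorem mul_lintegral_rpow_le {α β : Type*} [MeasurableSpace α] [MeasurableSpace β]
    {μ : Measure α} {ν : Measure β} [SFinite μ] [SFinite ν] {g : β → ℝ≥0∞} {k : α → β → ℝ≥0∞}
    (hg : Measurable g) (hk : Measurable (Function.uncurry k)) (hk1 : ∀ x u, k x u ≤ 1) {A : ℝ≥0∞}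
    (hA : ∀ u, ∫⁻ x, k x u ∂μ = A) (hfin : ∫⁻ u, g u ∂ν ≠ ⊤) {b : ℝ} (hb : 0 < b) (hb1 : b ≤ 1) :
    A * (∫⁻ u, g u ∂ν) ^ b ≤ ∫⁻ x, (∫⁻ u, g u * k x u ∂ν) ^ b ∂μ := by
  set I := ∫⁻ u, g u ∂ν with hI
  by_cases h0 : I = 0
  · simp [h0, hb]
  have hgk : Measurable (Function.uncurry fun x u => g u * k x u) :=
    (hg.comp measurable_snd).mul hk
  have hTm : Measurable fun x => ∫⁻ u, g u * k x u ∂ν := hgk.lintegral_prod_right'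
  have hT : ∀ x, ∫⁻ u, g u * k x u ∂ν ≤ I := fun x =>
    lintegral_mono fun u => mul_le_of_le_one_right' (hk1 x u)
  -- The inner integral `T(x)` is at most `I` since `k ≤ 1`, so `T = T^b T^(1-b) ≤ T^b I^(1-b)`; by
  -- Tonelli `∫ T = A I`. Finiteness of `I` allows the factor `I^(1-b)` to be cancelled.
  have h1 : A * I ≤ (∫⁻ x, (∫⁻ u, g u * k x u ∂ν) ^ b ∂μ) * I ^ (1 - b) := by
    calc A * I = ∫⁻ u, ∫⁻ x, g u * k x u ∂μ ∂ν := by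
          rw [hI, mul_comm, ← lintegral_mul_const _ hg]
          refine lintegral_congr fun u => ?_
          exact (by rw [lintegral_const_mul (g u)
            (show Measurable fun x => k x u from hk.comp (measurable_id.prodMk measurable_const)), hA])
      _ = ∫⁻ x, ∫⁻ u, g u * k x u ∂ν ∂μ := (lintegral_lintegral_swap hgk.aemeasurable).symm
      _ ≤ ∫⁻ x, (∫⁻ u, g u * k x u ∂ν) ^ b * I ^ (1 - b) ∂μ := by
          refine lintegral_mono fun x => ?_
          calc _ = (∫⁻ u, g u * k x u ∂ν) ^ (b + (1 - b)) := by simp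
            _ = (∫⁻ u, g u * k x u ∂ν) ^ b * (∫⁻ u, g u * k x u ∂ν) ^ (1 - b) :=
                ENNReal.rpow_add_of_nonneg _ _ hb.le (by linarith)
            _ ≤ _ := by
                gcongr
                exact hT x
      _ = _ := lintegral_mul_const _ (hTm.pow_const _)
  have h2 : I = I ^ b * I ^ (1 - b) := by
    rw [← ENNReal.rpow_add_of_nonneg _ _ hb.le (by linarith)]; simp
  have h3 : A * I ^ b * I ^ (1 - b) ≤
      (∫⁻ x, (∫⁻ u, g u * k x u ∂ν) ^ b ∂μ) * I ^ (1 - b) := by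
    rwa [mul_assoc, ← h2]
  refine (ENNReal.mul_le_mul_iff_left ?_ ?_).1 h3
  · simp [ENNReal.rpow_eq_zero_iff, h0, hfin]
  · exact ENNReal.rpow_ne_top_of_nonneg (by linarith) hfin

variable {d : ℕ}

theorem lintegral_comp_smul_rspace {g : RSpace d → ℝ≥0∞} (hg : Measurable g) {r : ℝ} (hr : r ≠ 0) :
    ∫⁻ u, g (r • u) = ENNReal.ofReal |(r ^ d)⁻¹| * ∫⁻ u, g u := by
  rw [← lintegral_map hg (measurable_const_smul r), Measure.map_addHaar_smul _ hr,
    lintegral_smul_measure, finrank_euclideanSpace_fin, smul_eq_mul]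

/-- Exhaustion by balls removes the finiteness assumption of `mul_lintegral_rpow_le`. This matters
because `|f|^p e^{-u²/2}` is not known in advance to be integrable: the rate of `|f|^p` is only
known to be below `p`. -/
theorem mul_lintegral_gaussian_rpow_le {g : RSpace d → ℝ≥0∞} (hg : Measurable g)
    (hfin : ∀ R : ℝ, ∫⁻ u in Metric.closedBall 0 R, g u ≠ ⊤) {b c : ℝ} (hb : 0 < b) (hb1 : b ≤ 1)
    (hc : 0 < c) (σ : ℝ) :
    (∫⁻ x : RSpace d, ENNReal.ofReal (Real.exp (-c * ‖x‖ ^ 2))) * (∫⁻ u, g u) ^ b ≤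
      ∫⁻ x, (∫⁻ u, g u * ENNReal.ofReal (Real.exp (-c * ‖x - σ • u‖ ^ 2))) ^ b := by
  set A := ∫⁻ x : RSpace d, ENNReal.ofReal (Real.exp (-c * ‖x‖ ^ 2)) with hA
  have hA' : ∀ u : RSpace d, ∫⁻ x, ENNReal.ofReal (Real.exp (-c * ‖x - σ • u‖ ^ 2)) = A := fun u =>
    lintegral_sub_right_eq_self (fun x => ENNReal.ofReal (Real.exp (-c * ‖x‖ ^ 2))) (σ • u)
  have hAtop : A ≠ ⊤ := (integrable_exp_neg_mul_norm_sq hc).lintegral_lt_top.ne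
  have hlim : Filter.Tendsto (fun n : ℕ => ∫⁻ u in Metric.closedBall 0 (n : ℝ), g u) Filter.atTop
      (nhds (∫⁻ u, g u)) :=
    (aecover_closedBall (μ := volume) (x := (0 : RSpace d))
      tendsto_natCast_atTop_atTop).lintegral_tendsto_of_nat hg.aemeasurable
  have hlim2 : Filter.Tendsto (fun n : ℕ => A * (∫⁻ u in Metric.closedBall 0 (n : ℝ), g u) ^ b)
      Filter.atTop (nhds (A * (∫⁻ u, g u) ^ b)) :=
    ENNReal.Tendsto.const_mul ((ENNReal.continuous_rpow_const.tendsto _).comp hlim)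
      (Or.inr hAtop)
  refine le_of_tendsto' hlim2 fun n => ?_
  refine (mul_lintegral_rpow_le (μ := volume) (ν := volume.restrict (Metric.closedBall 0 (n : ℝ)))
    (k := fun x u => ENNReal.ofReal (Real.exp (-c * ‖x - σ • u‖ ^ 2))) hg
    (Measurable.ennreal_ofReal (Continuous.measurable (by fun_prop))) (fun x u => ?_) hA' (hfin n) hb
    hb1).trans ?_
  · rw [ENNReal.ofReal_le_one, Real.exp_le_one_iff]
    nlinarith [mul_nonneg hc.le (sq_nonneg ‖x - σ • u‖)]
  · gcongr
    exact Measure.restrict_le_self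

/-- The inverse transform is bounded from the weighted `L^p'` norm to the norm of `L^p(ρ)`. -/
theorem exists_lintegral_sbInverse_rpow_le (d : ℕ) {p : ℝ} (hp : 2 ≤ p) :
    ∃ K : ℝ≥0∞, K ≠ ⊤ ∧ ∀ F : CSpace d → ℂ, IsSubGaussian F →
      ∫⁻ u, ‖sbInverse F u‖ₑ ^ p * ENNReal.ofReal (Real.exp (-(‖u‖ ^ 2 / 2))) ≤
        K * (∫⁻ q : RSpace d × RSpace d,
          ‖F (complexPoint q.1 q.2) * (rangeWeight (1 / (p - 1)) q : ℂ)‖ₑ ^ (p / (p - 1))) ^ (p - 1) := by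
  obtain ⟨C, hC, hHY⟩ := exists_lintegral_enorm_fourier_rpow_le (V := RSpace d) hp
  have hp0 : 0 < p := by linarith
  have hp1 : 0 < p - 1 := by linarith
  set b := 1 / (p - 1) with hb
  have hb0 : 0 < b := by positivity
  have hb1 : b ≤ 1 := by rw [hb, div_le_one hp1]; linarith
  have hbp : (p - 1) * b = 1 := by rw [hb]; field_simp
  -- Completing the square: `p|x-u|²/2 + p x²/(2(p-1)) = u²/2 + c |x - ((p-1)/p) u|²`.
  set c := p ^ 2 / (2 * (p - 1)) with hc
  have hc0 : 0 < c := by positivity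
  set A := ∫⁻ x : RSpace d, ENNReal.ofReal (Real.exp (-c * ‖x‖ ^ 2)) with hA
  have hAi := integrable_exp_neg_mul_norm_sq (d := d) hc0
  have hAtop : A ≠ ⊤ := hAi.lintegral_lt_top.ne
  have hA0 : A ≠ 0 := by
    rw [hA, ne_eq, lintegral_eq_zero_iff (by fun_prop)]
    intro h
    obtain ⟨x, hx⟩ := h.exists
    exact absurd hx (ENNReal.ofReal_pos.2 (Real.exp_pos _)).ne'
  set κ : ℝ := (2 * Real.pi) ^ (-(d : ℝ) / 2) with hκ
  have hκ0 : 0 < κ := by positivity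
  set C' : ℝ≥0∞ := ENNReal.ofReal κ ^ p * (ENNReal.ofReal |(((2 * Real.pi)⁻¹) ^ d)⁻¹| * C) with hC'
  have hC't : C' ≠ ⊤ := ENNReal.mul_ne_top
    (ENNReal.rpow_ne_top_of_nonneg hp0.le ENNReal.ofReal_ne_top)
    (ENNReal.mul_ne_top ENNReal.ofReal_ne_top hC)
  refine ⟨(A⁻¹ * C' ^ b) ^ (p - 1), ENNReal.rpow_ne_top_of_nonneg hp1.le
    (ENNReal.mul_ne_top (ENNReal.inv_ne_top.2 hA0) (ENNReal.rpow_ne_top_of_nonneg hb0.le hC't)),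
    fun F hF => ?_⟩
  have hfc := hF.continuous_sbInverse
  have hFc := hF.differentiable.continuous
  set g : RSpace d → ℝ≥0∞ := fun u =>
    ‖sbInverse F u‖ₑ ^ p * ENNReal.ofReal (Real.exp (-(‖u‖ ^ 2 / 2))) with hg
  have hgm : Measurable g := by
    have := hfc.measurable
    fun_prop
  have hslice : ∀ x, ∫⁻ u, ‖sbInverse F u * (Real.exp (-(‖x - u‖ ^ 2 / 2)) : ℂ)‖ₑ ^ p ≤
      C' * (∫⁻ y, ‖fiber F x y‖ₑ ^ (p / (p - 1))) ^ (p - 1) := by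
    intro x
    have hm : Measurable fun w => ‖𝓕 (fiber F x) w‖ₑ ^ p :=
      (continuous_fourier_of_integrable (hF.integrable_fiber x)).measurable.enorm.pow_const _
    calc _ = ∫⁻ u, ENNReal.ofReal κ ^ p * ‖𝓕 (fiber F x) ((2 * Real.pi)⁻¹ • u)‖ₑ ^ p := by
          refine lintegral_congr fun u => ?_
          rw [← hF.fourier_fiber x u, ← hκ, enorm_mul, ENNReal.mul_rpow_of_nonneg _ _ hp0.le,
            ← ofReal_norm (κ : ℂ), Complex.norm_of_nonneg hκ0.le]
      _ = ENNReal.ofReal κ ^ p * (ENNReal.ofReal |(((2 * Real.pi)⁻¹) ^ d)⁻¹| *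
            ∫⁻ w, ‖𝓕 (fiber F x) w‖ₑ ^ p) := by
          rw [lintegral_const_mul _ (show Measurable fun u : RSpace d =>
              ‖𝓕 (fiber F x) ((2 * Real.pi)⁻¹ • u)‖ₑ ^ p from hm.comp (measurable_const_smul _)),
            lintegral_comp_smul_rspace hm (inv_ne_zero Real.two_pi_pos.ne')]
      _ ≤ _ := by
          rw [hC', mul_assoc, mul_assoc]
          gcongr
          exact hHY _ (hF.integrable_fiber x) (hF.continuous_fiber x).measurable
  -- The power `b` undoes the `p - 1` of Hausdorff-Young and, as `p b = p/(p-1)`, turns the inserted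
  -- factor `e ^ p` into the `x`-part of the range weight.
  have hT : ∀ x, (∫⁻ u, g u * ENNReal.ofReal (Real.exp (-c * ‖x - ((p - 1) / p) • u‖ ^ 2))) ^ b ≤
      C' ^ b * ∫⁻ y, ‖F (complexPoint x y) * (rangeWeight b (x, y) : ℂ)‖ₑ ^ (p / (p - 1)) := by
    intro x
    set e : ℝ≥0∞ := ENNReal.ofReal (Real.exp (-(‖x‖ ^ 2 * b / 2))) with he
    have h1 : ∀ u, g u * ENNReal.ofReal (Real.exp (-c * ‖x - ((p - 1) / p) • u‖ ^ 2)) =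
        ‖sbInverse F u * (Real.exp (-(‖x - u‖ ^ 2 / 2)) : ℂ)‖ₑ ^ p * e ^ p := by
      intro u
      rw [hg, enorm_mul, ENNReal.mul_rpow_of_nonneg _ _ hp0.le, he,
        ← ofReal_norm (Real.exp (-(‖x - u‖ ^ 2 / 2)) : ℂ), Complex.norm_of_nonneg (Real.exp_pos _).le,
        ENNReal.ofReal_rpow_of_pos (Real.exp_pos _), ENNReal.ofReal_rpow_of_pos (Real.exp_pos _),
        mul_assoc, mul_assoc, ← ENNReal.ofReal_mul (Real.exp_pos _).le,
        ← ENNReal.ofReal_mul (Real.rpow_nonneg (Real.exp_pos _).le _), ← Real.exp_mul,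
        ← Real.exp_mul, ← Real.exp_add, ← Real.exp_add]
      congr 3
      rw [norm_sub_sq_real, norm_sub_sq_real, norm_smul, real_inner_smul_right, hc, hb,
        Real.norm_of_nonneg (by positivity)]
      field_simp
      ring
    have h2 : ∀ y, ‖F (complexPoint x y) * (rangeWeight b (x, y) : ℂ)‖ₑ ^ (p / (p - 1)) =
        ‖fiber F x y‖ₑ ^ (p / (p - 1)) * e ^ (p / (p - 1)) := by
      intro y
      rw [← ENNReal.mul_rpow_of_nonneg _ _ (by positivity)]
      congr 1
      rw [← ofReal_norm, ← ofReal_norm, norm_fiber, he, ← ENNReal.ofReal_mul (by positivity),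
        norm_mul, Complex.norm_of_nonneg (by unfold rangeWeight; positivity), rangeWeight,
        mul_assoc]
    have hfm : Measurable fun y => ‖fiber F x y‖ₑ ^ (p / (p - 1)) :=
      (hF.continuous_fiber x).measurable.enorm.pow_const _
    simp only [h1, h2]
    rw [lintegral_mul_const _ (by
        have := hfc.measurable
        fun_prop), lintegral_mul_const _ hfm, ENNReal.mul_rpow_of_nonneg _ _ hb0.le,
      ← ENNReal.rpow_mul e, show p * b = p / (p - 1) by rw [hb]; ring, ← mul_assoc]
    gcongr
    calc _ ≤ (C' * (∫⁻ y, ‖fiber F x y‖ₑ ^ (p / (p - 1))) ^ (p - 1)) ^ b := by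
          gcongr; exact hslice x
      _ = _ := by
          rw [ENNReal.mul_rpow_of_nonneg _ _ hb0.le, ← ENNReal.rpow_mul, hbp, ENNReal.rpow_one]
  set N := ∫⁻ q : RSpace d × RSpace d,
    ‖F (complexPoint q.1 q.2) * (rangeWeight b q : ℂ)‖ₑ ^ (p / (p - 1)) with hN
  have hW : Continuous (rangeWeight (d := d) b) := by unfold rangeWeight; fun_prop
  have hNm : Measurable fun q : RSpace d × RSpace d =>
      ‖F (complexPoint q.1 q.2) * (rangeWeight b q : ℂ)‖ₑ ^ (p / (p - 1)) := by
    refine Measurable.pow_const (Continuous.measurable ?_) _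
    fun_prop
  have hN' : N = ∫⁻ x, ∫⁻ y, ‖F (complexPoint x y) * (rangeWeight b (x, y) : ℂ)‖ₑ ^ (p / (p - 1)) := by
    rw [hN, Measure.volume_eq_prod, lintegral_prod _ hNm.aemeasurable]
  have hfin : ∀ R : ℝ, ∫⁻ u in Metric.closedBall 0 R, g u ≠ ⊤ := by
    intro R
    have hgr : ∀ u, g u = ENNReal.ofReal (‖sbInverse F u‖ ^ p * Real.exp (-(‖u‖ ^ 2 / 2))) := by
      intro u
      rw [ENNReal.ofReal_mul (by positivity), ← ENNReal.ofReal_rpow_of_nonneg (norm_nonneg _) hp0.le,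
        ofReal_norm]
    have hcont : Continuous fun u => ‖sbInverse F u‖ ^ p * Real.exp (-(‖u‖ ^ 2 / 2)) :=
      (hfc.norm.rpow_const fun _ => Or.inr hp0.le).mul (by fun_prop)
    simp only [hgr]
    exact (hcont.continuousOn.integrableOn_compact (isCompact_closedBall 0 R)).lintegral_lt_top.ne
  have hmain : A * (∫⁻ u, g u) ^ b ≤ C' ^ b * N := by
    refine (mul_lintegral_gaussian_rpow_le hgm hfin hb0 hb1 hc0 ((p - 1) / p)).trans ?_
    rw [hN', ← lintegral_const_mul _ hNm.lintegral_prod_right']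
    exact lintegral_mono hT
  have h1 : (∫⁻ u, g u) ^ b ≤ A⁻¹ * C' ^ b * N := by
    rw [mul_assoc, ← ENNReal.mul_le_iff_le_inv hA0 hAtop]
    exact hmain
  calc ∫⁻ u, g u = ((∫⁻ u, g u) ^ b) ^ (p - 1) := by
        rw [← ENNReal.rpow_mul, mul_comm b, hbp, ENNReal.rpow_one]
    _ ≤ (A⁻¹ * C' ^ b * N) ^ (p - 1) := by gcongr
    _ = _ := ENNReal.mul_rpow_of_nonneg _ _ hp1.le

end NormEstimate

/-! ### Convergence of dilates in the weighted norm -/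

section Dilation

/-- Pointwise convergence together with convergence of the norms from above gives convergence in
`L^s`. -/
theorem tendsto_lintegral_enorm_sub_rpow {α : Type*} [MeasurableSpace α] {μ : Measure α}
    {f : ℕ → α → ℂ} {g : α → ℂ} {s : ℝ} (hs : 1 ≤ s) (hf : ∀ n, Measurable (f n))
    (hg : Measurable g) (hlim : ∀ x, Filter.Tendsto (fun n => f n x) Filter.atTop (nhds (g x)))
    {c : ℕ → ℝ≥0∞} (hc : Filter.Tendsto c Filter.atTop (nhds 1))
    (hle : ∀ n, ∫⁻ x, ‖f n x‖ₑ ^ s ∂μ ≤ c n * ∫⁻ x, ‖g x‖ₑ ^ s ∂μ)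
    (hfin : ∫⁻ x, ‖g x‖ₑ ^ s ∂μ ≠ ⊤) :
    Filter.Tendsto (fun n => ∫⁻ x, ‖f n x - g x‖ₑ ^ s ∂μ) Filter.atTop (nhds 0) := by
  have hs0 : 0 < s := by linarith
  set N := ∫⁻ x, ‖g x‖ₑ ^ s ∂μ with hN
  set κ : ℝ≥0∞ := 2 ^ (s - 1) with hκ
  have hκt : κ ≠ ⊤ := ENNReal.rpow_ne_top_of_nonneg (by linarith) ENNReal.ofNat_ne_top
  have hdm : ∀ n, Measurable fun x => ‖f n x - g x‖ₑ ^ s := fun n =>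
    ((hf n).sub hg).enorm.pow_const _
  -- By convexity nothing is truncated in this subtraction. Fatou for `h` bounds its integrals from
  -- below by `κ (N + N)` in the limit, while `hint` bounds the total from above by nearly the same,
  -- so the subtracted term tends to `0`.
  set h : ℕ → α → ℝ≥0∞ := fun n x => κ * (‖f n x‖ₑ ^ s + ‖g x‖ₑ ^ s) - ‖f n x - g x‖ₑ ^ s with hh
  have hhm : ∀ n, Measurable (h n) := fun n =>
    ((((hf n).enorm.pow_const _).add (hg.enorm.pow_const _)).const_mul _).sub (hdm n)
  have hsum : ∀ n x, h n x + ‖f n x - g x‖ₑ ^ s = κ * (‖f n x‖ₑ ^ s + ‖g x‖ₑ ^ s) := by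
    intro n x
    refine tsub_add_cancel_of_le ?_
    refine (ENNReal.rpow_le_rpow enorm_sub_le hs0.le).trans ?_
    exact ENNReal.rpow_add_le_mul_rpow_add_rpow _ _ hs
  have hint : ∀ n, ∫⁻ x, h n x ∂μ + ∫⁻ x, ‖f n x - g x‖ₑ ^ s ∂μ ≤ κ * (c n * N + N) := by
    intro n
    rw [← lintegral_add_left (hhm n)]
    simp only [hsum]
    rw [lintegral_const_mul' _ _ hκt,
      lintegral_add_left ((hf n).enorm.pow_const _)]
    gcongr
    exact hle n
  have hXlim : Filter.Tendsto (fun n => κ * (c n * N + N)) Filter.atTop (nhds (κ * (N + N))) := by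
    refine ENNReal.Tendsto.const_mul (Filter.Tendsto.add ?_ tendsto_const_nhds) (Or.inr hκt)
    simpa using ENNReal.Tendsto.mul_const hc (Or.inr hfin)
  have hpt : ∀ x, Filter.Tendsto (fun n => h n x) Filter.atTop
      (nhds (κ * (‖g x‖ₑ ^ s + ‖g x‖ₑ ^ s))) := by
    intro x
    have h1 : Filter.Tendsto (fun n => ‖f n x‖ₑ ^ s) Filter.atTop (nhds (‖g x‖ₑ ^ s)) :=
      (ENNReal.continuous_rpow_const.tendsto _).comp ((continuous_enorm.tendsto _).comp (hlim x))
    have h2 : Filter.Tendsto (fun n => ‖f n x - g x‖ₑ ^ s) Filter.atTop (nhds 0) := by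
      have h3 : Filter.Tendsto (fun n => f n x - g x) Filter.atTop (nhds 0) := by
        simpa using (hlim x).sub_const (g x)
      have := (ENNReal.continuous_rpow_const (y := s).tendsto _).comp
        ((continuous_enorm.tendsto _).comp h3)
      simpa [hs0, Function.comp_def] using this
    have := ENNReal.Tendsto.sub (ENNReal.Tendsto.const_mul (h1.add_const (‖g x‖ₑ ^ s))
      (Or.inr hκt)) h2 (Or.inr ENNReal.zero_ne_top)
    simpa using this
  have hliminf : κ * (N + N) ≤ Filter.liminf (fun n => ∫⁻ x, h n x ∂μ) Filter.atTop := by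
    refine le_trans (le_of_eq ?_) (lintegral_liminf_le hhm)
    simp only [(hpt _).liminf_eq]
    rw [lintegral_const_mul' _ _ hκt,
      lintegral_add_left (hg.enorm.pow_const _)]
  have hLt : κ * (N + N) ≠ ⊤ := ENNReal.mul_ne_top hκt (ENNReal.add_ne_top.2 ⟨hfin, hfin⟩)
  rw [ENNReal.tendsto_nhds_zero]
  intro ε hε
  by_cases hεt : ε = ⊤
  · simp [hεt]
  have hε2 : 0 < ε / 2 := ENNReal.half_pos hε.ne'
  have e1 : ∀ᶠ n in Filter.atTop, κ * (N + N) - ε / 2 ≤ ∫⁻ x, h n x ∂μ := by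
    rcases le_or_gt (κ * (N + N)) (ε / 2) with hl | hl
    · simp [tsub_eq_zero_of_le hl]
    · have : κ * (N + N) - ε / 2 < κ * (N + N) :=
        ENNReal.sub_lt_self hLt (lt_of_le_of_lt zero_le hl).ne' hε2.ne'
      filter_upwards [Filter.eventually_lt_of_lt_liminf (this.trans_le hliminf)] with n hn
      exact hn.le
  have e2 : ∀ᶠ n in Filter.atTop, κ * (c n * N + N) < κ * (N + N) + ε / 2 :=
    hXlim.eventually_lt_const (ENNReal.lt_add_right hLt hε2.ne')
  filter_upwards [e1, e2] with n h1 h2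
  have h3 : ∫⁻ x, h n x ∂μ + ∫⁻ x, ‖f n x - g x‖ₑ ^ s ∂μ ≤ ∫⁻ x, h n x ∂μ + ε := by
    calc _ ≤ κ * (N + N) + ε / 2 := (hint n).trans h2.le
      _ ≤ (κ * (N + N) - ε / 2 + ε / 2) + ε / 2 := by gcongr; exact le_tsub_add
      _ = (κ * (N + N) - ε / 2) + ε := by rw [add_assoc, ENNReal.add_halves]
      _ ≤ _ := by gcongr
  have h4 : ∫⁻ x, h n x ∂μ ≠ ⊤ := by
    refine ((le_self_add.trans (hint n)).trans_lt (h2.trans ?_)).ne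
    exact ENNReal.add_lt_top.2 ⟨hLt.lt_top, (ENNReal.half_lt_self hε.ne' hεt).trans_le le_top⟩
  exact (ENNReal.add_le_add_iff_left h4).1 h3

variable {d : ℕ}

theorem continuous_rangeWeight (b : ℝ) : Continuous (rangeWeight (d := d) b) := by
  unfold rangeWeight; fun_prop

theorem rangeWeight_pos (b : ℝ) (q : RSpace d × RSpace d) : 0 < rangeWeight b q := by
  unfold rangeWeight; positivity

theorem rangeWeight_le_comp_smul {b : ℝ} (hb : 0 ≤ b) {r : ℝ} (hr : 0 ≤ r) (hr1 : r ≤ 1)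
    (q : RSpace d × RSpace d) : rangeWeight b q ≤ rangeWeight b (r • q) := by
  unfold rangeWeight
  have h1 : ∀ v : RSpace d, ‖r • v‖ ≤ ‖v‖ := by
    intro v
    rw [norm_smul, Real.norm_of_nonneg hr]
    exact mul_le_of_le_one_left (norm_nonneg _) hr1
  simp only [Prod.smul_fst, Prod.smul_snd]
  gcongr <;> exact h1 _

/-- The weight decreases along rays, so replacing it by its dilate only increases the integral; the
change of variables then costs a Jacobian that tends to `1` as `r → 1`. -/
theorem lintegral_comp_smul_mul_rangeWeight_le {F : CSpace d → ℂ} (hF : Continuous F) {b s : ℝ}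
    (hb : 0 ≤ b) (hs : 0 ≤ s) {r : ℝ} (hr : 0 < r) (hr1 : r ≤ 1) :
    ∫⁻ q : RSpace d × RSpace d,
        ‖F ((r : ℂ) • complexPoint q.1 q.2) * (rangeWeight b q : ℂ)‖ₑ ^ s ≤
      ENNReal.ofReal ((r ^ Module.finrank ℝ (RSpace d × RSpace d))⁻¹) *
        ∫⁻ q : RSpace d × RSpace d, ‖F (complexPoint q.1 q.2) * (rangeWeight b q : ℂ)‖ₑ ^ s := by
  have hW := continuous_rangeWeight (d := d) b
  have hm : Measurable fun q : RSpace d × RSpace d =>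
      ‖F (complexPoint q.1 q.2) * (rangeWeight b q : ℂ)‖ₑ ^ s :=
    Measurable.pow_const (Continuous.measurable (by fun_prop)) _
  calc _ ≤ ∫⁻ q : RSpace d × RSpace d,
        ‖F (complexPoint (r • q).1 (r • q).2) * (rangeWeight b (r • q) : ℂ)‖ₑ ^ s := by
        refine lintegral_mono fun q => ?_
        rw [smul_complexPoint]
        refine ENNReal.rpow_le_rpow ?_ hs
        rw [enorm_mul, enorm_mul]
        gcongr
        · exact le_rfl
        · rw [← ofReal_norm, ← ofReal_norm, Complex.norm_of_nonneg (rangeWeight_pos _ _).le,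
            Complex.norm_of_nonneg (rangeWeight_pos _ _).le]
          exact ENNReal.ofReal_le_ofReal (rangeWeight_le_comp_smul hb hr.le hr1 q)
    _ = _ := by
        rw [← lintegral_map (f := fun q : RSpace d × RSpace d =>
          ‖F (complexPoint q.1 q.2) * (rangeWeight b q : ℂ)‖ₑ ^ s) hm (measurable_const_smul r),
          Measure.map_addHaar_smul _ hr.ne', lintegral_smul_measure, smul_eq_mul,
          abs_of_pos (by positivity)]

theorem tendsto_dilation {F : CSpace d → ℂ} (hF : Continuous F) {b s : ℝ}
    (hb : 0 ≤ b) (hs : 1 ≤ s) {r : ℕ → ℝ} (hr : ∀ n, 0 < r n) (hr1 : ∀ n, r n ≤ 1)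
    (hlim : Filter.Tendsto r Filter.atTop (nhds 1))
    (hfin : ∫⁻ q : RSpace d × RSpace d,
      ‖F (complexPoint q.1 q.2) * (rangeWeight b q : ℂ)‖ₑ ^ s ≠ ⊤) :
    Filter.Tendsto (fun n => ∫⁻ q : RSpace d × RSpace d,
      ‖F ((r n : ℂ) • complexPoint q.1 q.2) * (rangeWeight b q : ℂ) -
        F (complexPoint q.1 q.2) * (rangeWeight b q : ℂ)‖ₑ ^ s) Filter.atTop (nhds 0) := by
  have hW := continuous_rangeWeight (d := d) b
  refine tendsto_lintegral_enorm_sub_rpow hs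
    (fun n => Continuous.measurable (by fun_prop)) (Continuous.measurable (by fun_prop))
    (fun q => ?_) (c := fun n => ENNReal.ofReal
      (((r n) ^ Module.finrank ℝ (RSpace d × RSpace d))⁻¹)) ?_
    (fun n => lintegral_comp_smul_mul_rangeWeight_le hF hb (by linarith) (hr n) (hr1 n)) hfin
  · have h1 : Continuous fun t : ℝ => F ((t : ℂ) • complexPoint q.1 q.2) * (rangeWeight b q : ℂ) := by
      fun_prop
    simpa [Function.comp_def] using (h1.tendsto 1).comp hlim
  · have h1 : ContinuousAt (fun t : ℝ => ENNReal.ofReal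
        ((t ^ Module.finrank ℝ (RSpace d × RSpace d))⁻¹)) 1 :=
      ENNReal.continuous_ofReal.continuousAt.comp
        ((continuousAt_id.pow _).inv₀ (by simp))
    simpa [Function.comp_def] using h1.tendsto.comp hlim

end Dilation

/-! ### The transform on `L^p(ρ)`: continuity of evaluations and injectivity -/

section GaussianLp

variable {d : ℕ}

theorem gaussianDensity_eq (x : RSpace d) :
    gaussianDensity x = (2 * Real.pi) ^ (-(d : ℝ) / 2) * Real.exp (-(‖x‖ ^ 2 / 2)) := by
  simp [gaussianDensity, EuclideanSpace.norm_sq_eq, neg_div]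

theorem gaussianDensity_pos (x : RSpace d) : 0 < gaussianDensity x := by
  unfold gaussianDensity; positivity

theorem continuous_gaussianDensity : Continuous (gaussianDensity (d := d)) := by
  unfold gaussianDensity; fun_prop

theorem integrable_gaussianDensity : Integrable (gaussianDensity (d := d)) := by
  refine ((integrable_exp_neg_mul_norm_sq (d := d) (c := 1 / 2) (by norm_num)).const_mul
    ((2 * Real.pi) ^ (-(d : ℝ) / 2))).congr (Filter.Eventually.of_forall fun x => ?_)
  simp only [gaussianDensity_eq]
  ring_nf

theorem lintegral_gaussianMeasure {h : RSpace d → ℝ≥0∞} (hh : Measurable h) :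
    ∫⁻ x, h x ∂gaussianMeasure d = ∫⁻ x, h x * ENNReal.ofReal (gaussianDensity x) := by
  rw [gaussianMeasure, lintegral_withDensity_eq_lintegral_mul _
    continuous_gaussianDensity.measurable.ennreal_ofReal hh]
  exact lintegral_congr fun x => mul_comm _ _

theorem integral_gaussianMeasure (h : RSpace d → ℂ) :
    ∫ x, h x ∂gaussianMeasure d = ∫ x, (gaussianDensity x : ℂ) * h x := by
  rw [gaussianMeasure, integral_withDensity_eq_integral_toReal_smul
    continuous_gaussianDensity.measurable.ennreal_ofReal (by simp)]
  simp [ENNReal.toReal_ofReal (gaussianDensity_pos _).le]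

theorem integrable_gaussianMeasure_iff (h : RSpace d → ℂ) :
    Integrable h (gaussianMeasure d) ↔ Integrable fun x => (gaussianDensity x : ℂ) * h x := by
  rw [gaussianMeasure, integrable_withDensity_iff_integrable_smul'
    continuous_gaussianDensity.measurable.ennreal_ofReal (by simp)]
  simp [ENNReal.toReal_ofReal (gaussianDensity_pos _).le]

instance isFiniteMeasure_gaussianMeasure : IsFiniteMeasure (gaussianMeasure d) := by
  refine ⟨?_⟩
  rw [gaussianMeasure, withDensity_apply _ MeasurableSet.univ, setLIntegral_univ]
  exact integrable_gaussianDensity.lintegral_lt_top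

theorem gaussianMeasure_absolutelyContinuous : gaussianMeasure d ≪ volume :=
  withDensity_absolutelyContinuous _ _

/-- The kernel of the Segal-Bargmann transform with respect to the Gaussian measure. -/
noncomputable def sbKernel (z : CSpace d) (x : RSpace d) : ℂ :=
  Complex.exp (-(∑ j, z j ^ 2) / 2 + ∑ j, z j * x j)

theorem gaussianDensityC_sub (z : CSpace d) (x : RSpace d) :
    gaussianDensityC (z - complexPoint x 0) = (gaussianDensity x : ℂ) * sbKernel z x := by
  rw [gaussianDensityC, gaussianDensity, sbKernel]
  push_cast
  rw [mul_assoc, ← Complex.exp_add]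
  congr 2
  have : ∑ j, (z - complexPoint x 0) j ^ 2 =
      ∑ j, z j ^ 2 - 2 * ∑ j, z j * x j + ∑ j, (x j : ℂ) ^ 2 := by
    rw [Finset.mul_sum, ← Finset.sum_sub_distrib, ← Finset.sum_add_distrib]
    refine Finset.sum_congr rfl fun j _ => ?_
    simp [complexPoint]
    ring
  rw [this]
  ring

theorem segalBargmann_eq_integral_gaussianMeasure (f : RSpace d → ℂ) (z : CSpace d) :
    segalBargmann f z = ∫ x, sbKernel z x * f x ∂gaussianMeasure d := by
  rw [segalBargmann, integral_gaussianMeasure]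
  simp only [gaussianDensityC_sub, mul_assoc]

theorem memLp_sbKernel (z : CSpace d) {s : ℝ} (hs : 0 < s) :
    MemLp (sbKernel z) (ENNReal.ofReal s) (gaussianMeasure d) := by
  obtain ⟨a, b, rfl⟩ := exists_eq_complexPoint z
  set κ : ℝ := (2 * Real.pi) ^ (-(d : ℝ) / 2) with hκ
  set c₀ : ℝ := (-(∑ j, complexPoint a b j ^ 2) / 2).re
  have hc : Continuous (sbKernel (complexPoint a b)) := by unfold sbKernel; fun_prop
  refine ⟨hc.aestronglyMeasurable, ?_⟩
  rw [eLpNorm_lt_top_iff_lintegral_rpow_enorm_lt_top (ENNReal.ofReal_pos.2 hs).ne'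
    ENNReal.ofReal_ne_top, ENNReal.toReal_ofReal hs.le,
    lintegral_gaussianMeasure (hc.measurable.enorm.pow_const _)]
  have hn : ∀ x, ‖sbKernel (complexPoint a b) x‖ = Real.exp (c₀ + inner ℝ a x) := by
    intro x
    rw [sbKernel, Complex.norm_exp, Complex.add_re, Complex.re_sum]
    congr 2
    simp only [PiLp.inner_apply, complexPoint]
    refine Finset.sum_congr rfl fun j _ => ?_
    simp [mul_comm]
  have he : ∀ x, ‖sbKernel (complexPoint a b) x‖ₑ ^ s * ENNReal.ofReal (gaussianDensity x) =
      ENNReal.ofReal (κ * Real.exp (s * c₀) *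
        Real.exp (-(1 / 2) * ‖x‖ ^ 2 + inner ℝ (s • a) x)) := by
    intro x
    rw [← ofReal_norm, hn, ENNReal.ofReal_rpow_of_pos (Real.exp_pos _), ← Real.exp_mul,
      ← ENNReal.ofReal_mul (Real.exp_pos _).le, gaussianDensity_eq, ← hκ, mul_left_comm, mul_assoc,
      ← Real.exp_add, ← Real.exp_add, real_inner_smul_left]
    ring_nf
  simp only [he]
  exact ((integrable_exp_neg_mul_norm_sq_add (by norm_num) _).const_mul _).lintegral_lt_top

theorem segalBargmann_congr_ae {f g : RSpace d → ℂ} (h : f =ᵐ[gaussianMeasure d] g) :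
    segalBargmann f = segalBargmann g := by
  ext z
  rw [segalBargmann_eq_integral_gaussianMeasure, segalBargmann_eq_integral_gaussianMeasure]
  refine integral_congr_ae ?_
  filter_upwards [h] with x hx
  rw [hx]

/-- Evaluating the Segal-Bargmann transform at a point is a continuous linear functional. -/
theorem exists_clm_segalBargmann {p p' : ℝ} (hpp' : p.HolderConjugate p')
    [Fact (1 ≤ ENNReal.ofReal p)] (z : CSpace d) :
    ∃ T : Lp ℂ (ENNReal.ofReal p) (gaussianMeasure d) →L[ℂ] ℂ,
      ∀ f : Lp ℂ (ENNReal.ofReal p) (gaussianMeasure d), segalBargmann f z = T f := by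
  have hc : (ENNReal.ofReal p').HolderConjugate (ENNReal.ofReal p) := hpp'.symm.ennrealOfReal
  have : Fact (1 ≤ ENNReal.ofReal p') := ⟨hc.one_le⟩
  have hk := memLp_sbKernel z hpp'.symm.pos
  refine ⟨ContinuousLinearMap.lpPairing (gaussianMeasure d) (ENNReal.ofReal p') (ENNReal.ofReal p)
    (ContinuousLinearMap.mul ℂ ℂ) (hk.toLp _), fun f => ?_⟩
  rw [ContinuousLinearMap.lpPairing_eq_integral, segalBargmann_eq_integral_gaussianMeasure]
  refine integral_congr_ae ?_
  filter_upwards [hk.coeFn_toLp] with x hx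
  simp [hx]

/-- At the purely imaginary point `-2πi w`, the transform is a nonzero constant times the Fourier
transform of `ρ f` at `w`. -/
theorem ae_eq_zero_of_segalBargmann_eq_zero {f : RSpace d → ℂ}
    (hf : Integrable f (gaussianMeasure d)) (h : segalBargmann f = 0) :
    f =ᵐ[gaussianMeasure d] 0 := by
  have hi := (integrable_gaussianMeasure_iff f).1 hf
  have hz : 𝓕 (fun x => (gaussianDensity x : ℂ) * f x) = 0 := by
    ext w
    have h1 := congrFun h (complexPoint 0 ((-(2 * Real.pi)) • w))
    rw [segalBargmann] at h1
    simp only [gaussianDensityC_sub, Pi.zero_apply] at h1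
    have h2 : ∀ x, (gaussianDensity x : ℂ) * sbKernel (complexPoint 0 ((-(2 * Real.pi)) • w)) x *
        f x = Complex.exp (-(∑ j, complexPoint 0 ((-(2 * Real.pi)) • w) j ^ 2) / 2) *
          (Complex.exp (((-2 * Real.pi * inner ℝ x w : ℝ) : ℂ) * Complex.I) •
            ((gaussianDensity x : ℂ) * f x)) := by
      intro x
      have h3 : ∑ j, complexPoint 0 ((-(2 * Real.pi)) • w) j * (x j : ℂ) =
          ((-2 * Real.pi * inner ℝ x w : ℝ) : ℂ) * Complex.I := by
        simp only [PiLp.inner_apply, complexPoint]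
        push_cast
        rw [Finset.mul_sum, Finset.sum_mul]
        refine Finset.sum_congr rfl fun j _ => ?_
        simp
        ring
      rw [sbKernel, h3, Complex.exp_add, smul_eq_mul]
      ring
    simp only [h2] at h1
    rw [integral_const_mul] at h1
    rw [Real.fourier_eq']
    exact (mul_eq_zero.1 h1).resolve_left (Complex.exp_ne_zero _)
  have h0 := ae_eq_zero_of_fourier_eq_zero hi hz
  refine gaussianMeasure_absolutelyContinuous.ae_le ?_
  filter_upwards [h0] with x hx
  exact (mul_eq_zero.1 hx).resolve_left (by exact_mod_cast (gaussianDensity_pos x).ne')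

/-- The norm estimate for the inverse transform, between `L^p(ρ)` and the weighted `L^p'`. -/
theorem exists_eLpNorm_sbInverse_le (d : ℕ) {p : ℝ} (hp : 2 ≤ p) :
    ∃ K : ℝ≥0∞, K ≠ ⊤ ∧ ∀ F : CSpace d → ℂ, IsSubGaussian F →
      eLpNorm (sbInverse F) (ENNReal.ofReal p) (gaussianMeasure d) ≤
        K * eLpNorm (fun q : RSpace d × RSpace d =>
          F (complexPoint q.1 q.2) * (rangeWeight (1 / (p - 1)) q : ℂ))
          (ENNReal.ofReal (p / (p - 1))) volume := by
  obtain ⟨K, hK, h⟩ := exists_lintegral_sbInverse_rpow_le d hp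
  have hp0 : 0 < p := by linarith
  have hp1 : 0 < p - 1 := by linarith
  have hs : 0 < p / (p - 1) := by positivity
  set κ : ℝ := (2 * Real.pi) ^ (-(d : ℝ) / 2) with hκ
  have hκ0 : 0 < κ := by positivity
  refine ⟨(ENNReal.ofReal κ * K) ^ (1 / p), ENNReal.rpow_ne_top_of_nonneg (by positivity)
    (ENNReal.mul_ne_top ENNReal.ofReal_ne_top hK), fun F hF => ?_⟩
  have hm := hF.continuous_sbInverse.measurable
  rw [eLpNorm_eq_lintegral_rpow_enorm_toReal (ENNReal.ofReal_pos.2 hp0).ne' ENNReal.ofReal_ne_top,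
    eLpNorm_eq_lintegral_rpow_enorm_toReal (ENNReal.ofReal_pos.2 hs).ne' ENNReal.ofReal_ne_top,
    ENNReal.toReal_ofReal hp0.le, ENNReal.toReal_ofReal hs.le,
    lintegral_gaussianMeasure (hm.enorm.pow_const _)]
  set N := ∫⁻ q : RSpace d × RSpace d,
    ‖F (complexPoint q.1 q.2) * (rangeWeight (1 / (p - 1)) q : ℂ)‖ₑ ^ (p / (p - 1))
  calc _ = (ENNReal.ofReal κ * ∫⁻ u, ‖sbInverse F u‖ₑ ^ p *
          ENNReal.ofReal (Real.exp (-(‖u‖ ^ 2 / 2)))) ^ (1 / p) := by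
        rw [← lintegral_const_mul _ (by fun_prop)]
        congr 1
        refine lintegral_congr fun u => ?_
        rw [gaussianDensity_eq, ENNReal.ofReal_mul hκ0.le, mul_left_comm]
    _ ≤ (ENNReal.ofReal κ * (K * N ^ (p - 1))) ^ (1 / p) := by
        gcongr
        exact h F hF
    _ = _ := by
        rw [← mul_assoc, ENNReal.mul_rpow_of_nonneg _ _ (by positivity), ← ENNReal.rpow_mul]
        congr 2
        field_simp

end GaussianLp

/-! ### Existence by approximation with dilates, and uniqueness -/

/-- Every entire function of finite weighted `L^p'` norm is the Segal-Bargmann transform of a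
unique element of `L^p(ρ)`. -/
theorem existsUnique_segalBargmann_eq (d : ℕ) {p : ℝ} (hp : 2 ≤ p) {F : CSpace d → ℂ}
    (hF : Differentiable ℂ F)
    (hint : ∫⁻ q : RSpace d × RSpace d,
      ‖F (complexPoint q.1 q.2) * (rangeWeight (1 / (p - 1)) q : ℂ)‖ₑ ^ (p / (p - 1)) < ⊤) :
    ∃! f : Lp ℂ (ENNReal.ofReal p) (gaussianMeasure d), segalBargmann f = F := by
  have hp0 : 0 < p := by linarith
  have hp1 : 0 < p - 1 := by linarith
  have hone : 1 ≤ ENNReal.ofReal p := by rw [ENNReal.one_le_ofReal]; linarith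
  have : Fact (1 ≤ ENNReal.ofReal p) := ⟨hone⟩
  have hpp' : p.HolderConjugate (p / (p - 1)) :=
    Real.HolderConjugate.conjExponent (by linarith)
  choose T hT using fun z : CSpace d => exists_clm_segalBargmann hpp' z
  have hFc := hF.continuous
  set s := p / (p - 1) with hs
  set b := 1 / (p - 1) with hb
  have hb0 : 0 ≤ b := by positivity
  have hb1 : b ≤ 1 := by rw [hb, div_le_one hp1]; linarith
  have hs1 : 1 ≤ s := by rw [hs, one_le_div hp1]; linarith
  have hs0 : 0 < s := by linarith
  have hW := continuous_rangeWeight (d := d) b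
  refine existsUnique_of_exists_of_unique ?_ ?_
  · obtain ⟨C, hC, hbd⟩ := exists_pointwise_bound hF hb1 hs1 hint
    obtain ⟨K, hK, hKle⟩ := exists_eLpNorm_sbInverse_le d hp
    -- The shift by `2` keeps `r 0` strictly positive.
    set r : ℕ → ℝ := fun n => 1 - 1 / ((n : ℝ) + 2) with hr
    have hr0 : ∀ n, 0 < r n := fun n => by
      rw [hr, sub_pos, div_lt_one (by positivity)]
      linarith [Nat.cast_nonneg (α := ℝ) n]
    have hr1 : ∀ n, r n < 1 := fun n => by
      rw [hr, sub_lt_self_iff]; positivity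
    have hrlim : Filter.Tendsto r Filter.atTop (nhds 1) := by
      have h1 : Filter.Tendsto (fun n : ℕ => 1 / ((n : ℝ) + 2)) Filter.atTop (nhds 0) :=
        tendsto_const_nhds.div_atTop (Filter.tendsto_atTop_add_const_right _ _
          tendsto_natCast_atTop_atTop)
      simpa [hr] using h1.const_sub 1
    set G : ℕ → CSpace d → ℂ := fun n z => F ((r n : ℂ) • z) with hG
    have hGs : ∀ n, IsSubGaussian (G n) := fun n =>
      isSubGaussian_comp_smul hF hC hbd (hr0 n) (hr1 n)
    set Φ : (CSpace d → ℂ) → RSpace d × RSpace d → ℂ := fun H q =>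
      H (complexPoint q.1 q.2) * (rangeWeight b q : ℂ) with hΦ
    set D : ℕ → ℝ≥0∞ := fun n => eLpNorm (Φ (G n) - Φ F) (ENNReal.ofReal s) volume with hD
    have hDlim : Filter.Tendsto D Filter.atTop (nhds 0) := by
      have h1 := tendsto_dilation hFc hb0 hs1 hr0 (fun n => (hr1 n).le) hrlim hint.ne
      have h2 := (ENNReal.continuous_rpow_const (y := 1 / s)).tendsto 0 |>.comp h1
      rw [ENNReal.zero_rpow_of_pos (by positivity)] at h2
      refine h2.congr fun n => ?_
      change _ = eLpNorm (Φ (G n) - Φ F) (ENNReal.ofReal s) volume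
      rw [eLpNorm_eq_lintegral_rpow_enorm_toReal (ENNReal.ofReal_pos.2 hs0).ne'
        ENNReal.ofReal_ne_top, ENNReal.toReal_ofReal hs0.le]
      rfl
    have hΦm : ∀ n, AEStronglyMeasurable (Φ (G n) - Φ F) volume := fun n =>
      Continuous.aestronglyMeasurable (by simp only [hΦ, hG]; fun_prop)
    have hΦF : MemLp (Φ F) (ENNReal.ofReal s) volume := by
      refine ⟨Continuous.aestronglyMeasurable (by simp only [hΦ]; fun_prop), ?_⟩
      rw [eLpNorm_lt_top_iff_lintegral_rpow_enorm_lt_top (ENNReal.ofReal_pos.2 hs0).ne'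
        ENNReal.ofReal_ne_top, ENNReal.toReal_ofReal hs0.le]
      exact hint
    have hΦG : ∀ n, MemLp (Φ (G n)) (ENNReal.ofReal s) volume := by
      intro n
      refine ⟨Continuous.aestronglyMeasurable (by simp only [hΦ, hG]; fun_prop), ?_⟩
      rw [eLpNorm_lt_top_iff_lintegral_rpow_enorm_lt_top (ENNReal.ofReal_pos.2 hs0).ne'
        ENNReal.ofReal_ne_top, ENNReal.toReal_ofReal hs0.le]
      exact (lintegral_comp_smul_mul_rangeWeight_le hFc hb0 hs0.le (hr0 n) (hr1 n).le).trans_lt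
        (ENNReal.mul_lt_top ENNReal.ofReal_lt_top hint)
    have hmem : ∀ n, MemLp (sbInverse (G n)) (ENNReal.ofReal p) (gaussianMeasure d) := fun n =>
      ⟨(hGs n).continuous_sbInverse.aestronglyMeasurable,
        (hKle _ (hGs n)).trans_lt (ENNReal.mul_lt_top hK.lt_top (hΦG n).2)⟩
    set f : ℕ → Lp ℂ (ENNReal.ofReal p) (gaussianMeasure d) := fun n => (hmem n).toLp _ with hf
    -- The inverse estimate is applied to `G m - G n`, itself sub-Gaussian; it is never applied to
    -- `F`, which need not be.
    have hdist : ∀ m n, edist (f m) (f n) ≤ K * (D m + D n) := by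
      intro m n
      have h1 : sbInverse (G m) - sbInverse (G n) = sbInverse fun z => G m z - G n z :=
        funext fun u => ((hGs m).sbInverse_sub (hGs n) u).symm
      rw [hf, Lp.edist_toLp_toLp, h1]
      refine (hKle _ ((hGs m).sub (hGs n))).trans ?_
      gcongr
      have h2 : (fun q : RSpace d × RSpace d =>
          (G m (complexPoint q.1 q.2) - G n (complexPoint q.1 q.2)) * (rangeWeight b q : ℂ)) =
          (Φ (G m) - Φ F) - (Φ (G n) - Φ F) := by
        ext q
        simp only [hΦ, Pi.sub_apply]
        ring
      rw [h2]
      exact eLpNorm_sub_le (hΦm m) (hΦm n) (ENNReal.one_le_ofReal.2 hs1)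
    have hcauchy : CauchySeq f := by
      rw [EMetric.cauchySeq_iff]
      intro ε hε
      have h1 : Filter.Tendsto (fun q : ℕ × ℕ => K * (D q.1 + D q.2))
          (Filter.atTop ×ˢ Filter.atTop) (nhds 0) := by
        have := ENNReal.Tendsto.const_mul ((hDlim.comp Filter.tendsto_fst).add
          (hDlim.comp Filter.tendsto_snd)) (Or.inr hK) (a := K)
        simpa using this
      rw [Filter.prod_atTop_atTop_eq] at h1
      obtain ⟨⟨M, N⟩, hMN⟩ := Filter.eventually_atTop.1 (h1.eventually_lt_const hε)
      refine ⟨max M N, fun m hm n hn => (hdist m n).trans_lt (hMN (m, n) ⟨?_, ?_⟩)⟩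
      · exact (le_max_left _ _).trans hm
      · exact (le_max_right _ _).trans hn
    obtain ⟨g, hg⟩ := cauchySeq_tendsto_of_complete hcauchy
    refine ⟨g, funext fun z => ?_⟩
    have h1 : Filter.Tendsto (fun n => T z (f n)) Filter.atTop (nhds (T z g)) :=
      ((T z).continuous.tendsto g).comp hg
    have h2 : ∀ n, T z (f n) = F ((r n : ℂ) • z) := by
      intro n
      rw [← hT z, segalBargmann_congr_ae (hmem n).coeFn_toLp, (hGs n).segalBargmann_sbInverse]
    have h3 : Filter.Tendsto (fun n => F ((r n : ℂ) • z)) Filter.atTop (nhds (F z)) := by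
      have h4 : Continuous fun t : ℝ => F ((t : ℂ) • z) := by fun_prop
      simpa [Function.comp_def] using (h4.tendsto 1).comp hrlim
    rw [hT z]
    simp only [h2] at h1
    exact tendsto_nhds_unique h1 h3
  · intro f g hf hg
    have h1 : segalBargmann (f - g : Lp ℂ (ENNReal.ofReal p) (gaussianMeasure d)) = 0 := by
      ext z
      rw [hT z, map_sub, ← hT z, ← hT z, hf, hg]
      simp
    -- The Gaussian measure is finite, so `L^p(ρ)` lies in `L¹(ρ)`.
    have h2 := ae_eq_zero_of_segalBargmann_eq_zero ((Lp.memLp (f - g)).integrable hone) h1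
    exact sub_eq_zero.1 ((Lp.eq_zero_iff_ae_eq_zero).2 h2)

theorem mainTheorem5 (d : ℕ) (p p' : ℝ) (hp : 2 ≤ p) (hpp' : p.HolderConjugate p')
    (F : CSpace d → ℂ) (hF : Differentiable ℂ F)
    (hint : ∫⁻ q : RSpace d × RSpace d,
      ENNReal.ofReal
        (‖F (complexPoint q.1 q.2) *
            ((Real.exp (-(‖q.2‖ ^ 2 / 2)) * Real.exp (-(‖q.1‖ ^ 2 / (2 * (p - 1)))) : ℝ) : ℂ)‖
          ^ p') < ⊤) :
    ∃! f : Lp ℂ (ENNReal.ofReal p) (gaussianMeasure d), segalBargmann f = F := by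
  obtain rfl : p' = p / (p - 1) := hpp'.conjExponent_eq.symm
  refine existsUnique_segalBargmann_eq d hp hF (lt_of_eq_of_lt (lintegral_congr fun q => ?_) hint)
  rw [← ofReal_norm, ENNReal.ofReal_rpow_of_nonneg (norm_nonneg _) hpp'.symm.nonneg, rangeWeight]
  congr 7
  field_simp
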